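/- Notation. $T_n$ is the $n$-th Chebyshev polynomial of the first kind. For $f:[-1,1]\to\mathbb R$ put $\alpha_n[f]=\frac{2}{\pi}\int_{-1}^{1}\frac{f(t)T_n(t)}{\sqrt{1-t^2}}\,dt$. For a real square matrix $A$ put $\mathcal S_N(f)(A)=\sum_{n=0}^{N}{}'\,\alpha_n[f]\,T_n(A)$, where the dash means that the term $n=0$ is halved. If all eigenvalues of $A$ are real and lie in $[-1,1]$, and $A=Z^{-1}JZ$ is a Jordan form of $A$, then $f(A)=Z^{-1}f(J)Z$, where $f(J)$ is block diagonal and the block of $f(J)$ that belongs to a Jordan block with eigenvalue $\lambda$ is upper triangular with entries $f^{(q-p)}(\lambda)/(q-p)!$ for $p\le q$ (derivatives at $\pm1$ are one-sided). Theorem. Let $\ell\ge 1$, let $A$ be a real $k\times k$ matrix all of whose eigenvalues are real and lie in $[-1,1]$, and let $m$ be the size of the largest Jordan block in a Jordan form of $A$. Let $f\in C^{2m+2\ell}([-1,1])$ be such that $f^{(2m+2\ell)}$ is absolutely continuous and $f^{(2m+2\ell+1)}$ (which exists almost everywhere) is of bounded variation, i.e. agrees almost everywhere with a function of bounded variation.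 Let $\|\cdot\|$ be any norm on the real $k\times k$ matrices. Then the series $$G(t)=\sum_{n=0}^{\infty}{}'\,\alpha_n[f]\,T_n(A)\,T_n^{(\ell+1)}(t)$$ converges absolutely for every $t\in[-1,1]$, the function $t\mapsto\|G(t)\|$ is integrable on $[-1,1]$, and $$\|\mathcal S_N(f)(A)-f(A)\|\le \frac{C}{(N-\ell)^{\ell}}\quad\text{for all } N>\ell,\qquad C=\frac{2}{\ell}\int_{-1}^{1}\|G(t)\|\,dt .$$ In particular $C$ does not depend on $N$, and the size $k$ enters neither the factor $2/\ell$ nor the smoothness required of $f$: the constant depends on $A$, $k$ and the norm only through the function $t\mapsto\|G(t)\|$. -/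

import Mathlib

namespace ChebMatrix

open Polynomial

noncomputable section

/-! ### Jordan forms and matrix functions -/

/-- The upper triangular Jordan block of order `n` with eigenvalue `c`. -/
def jordanBlock (n : ℕ) (c : ℝ) : Matrix (Fin n) (Fin n) ℝ :=
  Matrix.of fun p q => if p = q then c else if p.val + 1 = q.val then 1 else 0

/-- A Jordan form `A = Z⁻¹ J Z` of a real matrix `A`, where `J` is block diagonal with
the real Jordan blocks of orders `size i` and eigenvalues `eig i` on its diagonal. -/
structure JordanForm {k : ℕ} (A : Matrix (Fin k) (Fin k) ℝ) where
  numBlocks : ℕ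
  size : Fin numBlocks → ℕ
  size_pos : ∀ i, 0 < size i
  eig : Fin numBlocks → ℝ
  Z : Matrix (Σ i, Fin (size i)) (Fin k) ℝ
  Zinv : Matrix (Fin k) (Σ i, Fin (size i)) ℝ
  mul_Zinv : Z * Zinv = 1
  Zinv_mul : Zinv * Z = 1
  eq_conj : A = Zinv * Matrix.blockDiagonal' (fun i => jordanBlock (size i) (eig i)) * Z

/-- The size of the largest Jordan block. -/
def JordanForm.maxBlockSize {k : ℕ} {A : Matrix (Fin k) (Fin k) ℝ} (D : JordanForm A) : ℕ :=
  Finset.univ.sup D.size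

/-- `f^(j)` on `[-1, 1]`, with one-sided derivatives at the end points. -/
def derivI (j : ℕ) (f : ℝ → ℝ) : ℝ → ℝ :=
  iteratedDerivWithin j f (Set.Icc (-1) 1)

/-- `f` of a Jordan block of order `n` with eigenvalue `c`: the upper triangular matrix with
entries `f^(q-p)(c) / (q-p)!` for `p ≤ q`. -/
def funJordanBlock (f : ℝ → ℝ) (n : ℕ) (c : ℝ) : Matrix (Fin n) (Fin n) ℝ :=
  Matrix.of fun p q =>
    if p ≤ q then derivI (q.val - p.val) f c / (Nat.factorial (q.val - p.val) : ℝ) else 0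

/-- The matrix function `f(A) = Z⁻¹ f(J) Z`, computed from the Jordan form `A = Z⁻¹ J Z`. -/
def JordanForm.matFun {k : ℕ} {A : Matrix (Fin k) (Fin k) ℝ} (D : JordanForm A) (f : ℝ → ℝ) :
    Matrix (Fin k) (Fin k) ℝ :=
  D.Zinv * Matrix.blockDiagonal' (fun i => funJordanBlock f (D.size i) (D.eig i)) * D.Z

/-! ### Chebyshev expansions -/

/-- The Chebyshev polynomial of the first kind `T_n`. -/
def chebT (n : ℕ) : ℝ[X] := Polynomial.Chebyshev.T ℝ (n : ℤ)

/-- The Chebyshev coefficient `α_n[f] = (2/π) ∫_{-1}^1 f(t) T_n(t) / √(1 - t²) dt`. -/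
def chebCoeff (f : ℝ → ℝ) (n : ℕ) : ℝ :=
  2 / Real.pi * ∫ t in (-1 : ℝ)..1, f t * (chebT n).eval t / Real.sqrt (1 - t ^ 2)

/-- The weight of the `n`-th term in a dashed sum, whose first term is halved. -/
def dashWeight (n : ℕ) : ℝ := if n = 0 then 1 / 2 else 1

/-- The truncated matrix Chebyshev expansion `S_N(f)(A) = ∑' α_n[f] T_n(A)`, `0 ≤ n ≤ N`. -/
def chebPartialSum {k : ℕ} (f : ℝ → ℝ) (N : ℕ) (A : Matrix (Fin k) (Fin k) ℝ) :
    Matrix (Fin k) (Fin k) ℝ :=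
  ∑ n ∈ Finset.range (N + 1), (dashWeight n * chebCoeff f n) • aeval A (chebT n)

/-- The `n`-th term of the dashed series `∑' α_n[f] T_n(A) T_n^(j)(t)`. -/
def chebDerivTerm {k : ℕ} (f : ℝ → ℝ) (A : Matrix (Fin k) (Fin k) ℝ) (j : ℕ) (t : ℝ) (n : ℕ) :
    Matrix (Fin k) (Fin k) ℝ :=
  (dashWeight n * chebCoeff f n * (derivative^[j] (chebT n)).eval t) • aeval A (chebT n)

/-! ### Regularity -/

/-- `f ∈ C^r([-1,1])`, `f^(r)` is absolutely continuous and `f^(r+1)` is of bounded variation.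
As `f^(r+1)` exists only almost everywhere, the last condition says that it agrees almost
everywhere with a function of bounded variation (finite total variation as a distribution). -/
def SmoothBV (r : ℕ) (f : ℝ → ℝ) : Prop :=
  ContDiffOn ℝ r f (Set.Icc (-1) 1) ∧
  AbsolutelyContinuousOnInterval (derivI r f) (-1) 1 ∧
  ∃ w : ℝ → ℝ, BoundedVariationOn w (Set.Icc (-1) 1) ∧
    ∀ᵐ x : ℝ, x ∈ Set.Ioo (-1 : ℝ) 1 → HasDerivAt (derivI r f) (w x) x

/-! ### Existence of Jordan forms -/

/-- `ℝ[X] / ((X - c) ^ e)` has a basis in which multiplication by `X` is a Jordan block. -/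
theorem exists_basis_quotient (q : ℝ[X]) (e : ℕ) (c : ℝ) (hq : Ideal.span {q} = Ideal.span {(X - C c) ^ e}) :
    ∃ b : Module.Basis (Fin e) ℝ (ℝ[X] ⧸ Ideal.span {q}), ∀ j : Fin e,
      (X : ℝ[X]) • b j = (C c : ℝ[X]) • b j + if h : j.val = 0 then 0 else b ⟨j.val - 1, by omega⟩ := by
  rw [hq]
  set I := Ideal.span {(X - C c : ℝ[X]) ^ e} with hI
  let v : Fin e → ℝ[X] ⧸ I := fun j => Ideal.Quotient.mk I ((X - C c) ^ (e - 1 - j.val))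
  have hz : ∀ n, e ≤ n → Ideal.Quotient.mk I ((X - C c) ^ n) = 0 := fun n hn =>
    Ideal.Quotient.eq_zero_iff_mem.2 (Ideal.mem_span_singleton.2 (pow_dvd_pow _ hn))
  have hspan : ⊤ ≤ Submodule.span ℝ (Set.range v) := by
    rintro x -
    obtain ⟨p, rfl⟩ := Ideal.Quotient.mk_surjective x
    rw [← Polynomial.sum_taylor_eq p c, Polynomial.sum_def, map_sum]
    refine Submodule.sum_mem _ fun n _ => ?_
    rw [← Polynomial.smul_eq_C_mul]
    have : Ideal.Quotient.mk I (((taylor c) p).coeff n • (X - C c) ^ n)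
      = ((taylor c) p).coeff n • Ideal.Quotient.mk I ((X - C c) ^ n) := rfl
    rw [this]
    refine Submodule.smul_mem _ _ ?_
    by_cases hn : e ≤ n
    · rw [hz n hn]; exact Submodule.zero_mem _
    · refine Submodule.subset_span ⟨⟨e - 1 - n, by omega⟩, ?_⟩
      simp only [v]
      congr 2
      omega
  have hcard : Fintype.card (Fin e) = Module.finrank ℝ (ℝ[X] ⧸ I) := by
    rw [hI, finrank_quotient_span_eq_natDegree]
    simp
  refine ⟨basisOfTopLeSpanOfCardEqFinrank v hspan hcard, fun j => ?_⟩
  simp only [coe_basisOfTopLeSpanOfCardEqFinrank]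
  have h1 : (X : ℝ[X]) • v j = Ideal.Quotient.mk I (X * (X - C c) ^ (e - 1 - j.val)) := rfl
  have h2 : (C c : ℝ[X]) • v j = Ideal.Quotient.mk I (C c * (X - C c) ^ (e - 1 - j.val)) := rfl
  have h3 : X * (X - C c) ^ (e - 1 - j.val) = C c * (X - C c) ^ (e - 1 - j.val)
      + (X - C c) ^ (e - 1 - j.val + 1) := by ring
  rw [h1, h2, h3, map_add]
  congr 1
  split_ifs with h
  · exact hz _ (by omega)
  · simp only [v]
    congr 2
    have := j.2
    omega

/-- A real matrix with real spectrum has a basis of Jordan chains. -/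
theorem exists_jordan_basis {k : ℕ} (A : Matrix (Fin k) (Fin k) ℝ) (hA : A.charpoly.Splits) :
    ∃ (ι : Type) (_ : Fintype ι) (size : ι → ℕ) (eig : ι → ℝ)
      (b : Module.Basis (Σ i, Fin (size i)) ℝ (Fin k → ℝ)), ∀ x : Σ i, Fin (size i),
      A.mulVec (b x) = eig x.1 • b x +
        if h : x.2.val = 0 then 0 else b ⟨x.1, ⟨x.2.val - 1, by omega⟩⟩ := by
  classical
  set T : Module.End ℝ (Fin k → ℝ) := Matrix.toLin' A with hT
  obtain ⟨ι, _, p, hp, e, ⟨φ⟩⟩ := Module.equiv_directSum_of_isTorsion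
    (Module.AEval.isTorsion_of_finiteDimensional ℝ (Fin k → ℝ) T)
  have hchar : ∀ m : Module.AEval ℝ (Fin k → ℝ) T, A.charpoly • m = 0 := by
    intro m
    obtain ⟨v, rfl⟩ := (Module.AEval.of ℝ (Fin k → ℝ) T).surjective m
    rw [← Module.AEval.of_aeval_smul]
    have : aeval T A.charpoly = 0 := by
      have h1 : T.charpoly = A.charpoly := by rw [hT, Matrix.charpoly_toLin']
      rw [← h1, LinearMap.aeval_self_charpoly]
    rw [this, zero_smul, map_zero]
  have hc : ∀ i, ∃ c : ℝ, Ideal.span {p i ^ e i} = Ideal.span {(X - C c) ^ e i} := by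
    intro i
    rcases Nat.eq_zero_or_pos (e i) with h0 | h0
    · exact ⟨0, by simp [h0]⟩
    have hd : p i ∣ A.charpoly := by
      have h1 : A.charpoly • (DirectSum.lof ℝ[X] ι (fun i => ℝ[X] ⧸ Submodule.span ℝ[X] {p i ^ e i}) i
          (Submodule.Quotient.mk 1)) = 0 := by
        obtain ⟨m, hm⟩ := φ.surjective (DirectSum.lof ℝ[X] ι
          (fun i => ℝ[X] ⧸ Submodule.span ℝ[X] {p i ^ e i}) i (Submodule.Quotient.mk 1))
        rw [← hm, ← map_smul, hchar, map_zero]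
      rw [← map_smul] at h1
      have h2 := congrArg (DirectSum.component ℝ[X] ι _ i) h1
      rw [DirectSum.component.lof_self, map_zero, ← Submodule.Quotient.mk_smul,
        Submodule.Quotient.mk_eq_zero, smul_eq_mul, mul_one, Ideal.submodule_span_eq,
        Ideal.mem_span_singleton] at h2
      exact (dvd_pow_self _ h0.ne').trans h2
    have h1 := (hA.of_dvd A.charpoly_monic.ne_zero hd).degree_eq_one_of_irreducible (hp i)
    obtain ⟨c, hc⟩ := Polynomial.exists_root_of_degree_eq_one h1
    refine ⟨c, Ideal.span_singleton_eq_span_singleton.2 (Associated.pow_pow ?_)⟩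
    exact ((irreducible_X_sub_C c).associated_of_dvd (hp i) (dvd_iff_isRoot.2 hc)).symm
  choose c hc using hc
  choose b hb using fun i => exists_basis_quotient (p i ^ e i) (e i) (c i) (hc i)
  let B : Module.Basis (Σ i, Fin (e i)) ℝ (Fin k → ℝ) := 
    ((DFinsupp.basis b).map (φ.restrictScalars ℝ).symm).map (Module.AEval.of ℝ _ T).symm
  have hB : ∀ x : Σ i, Fin (e i), Module.AEval.of ℝ _ T (B x) = φ.symm (DirectSum.lof ℝ[X] ι
          (fun i => ℝ[X] ⧸ Submodule.span ℝ[X] {p i ^ e i}) x.1 (b x.1 x.2)) := by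
    rintro ⟨i, j⟩
    simp only [B, Module.Basis.map_apply, LinearEquiv.apply_symm_apply]
    have h1 : DFinsupp.basis b ⟨i, j⟩ = DFinsupp.single i (b i j) := by
      rw [Module.Basis.apply_eq_iff]
      change (sigmaFinsuppLequivDFinsupp ℝ).symm (DFinsupp.mapRange.linearEquiv (fun i => (b i).repr)
        (DFinsupp.single i (b i j))) = _
      rw [LinearEquiv.symm_apply_eq, DFinsupp.mapRange.linearEquiv_apply,
        DFinsupp.mapRange_single, Module.Basis.repr_self]
      exact (sigmaFinsuppEquivDFinsupp_single (⟨i, j⟩ : Σ i, Fin (e i)) (1 : ℝ)).symm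
    rw [h1]
    rfl
  have key : ∀ x : Σ i, Fin (e i), A.mulVec (B x) = c x.1 • B x +
        if h : x.2.val = 0 then 0 else B ⟨x.1, ⟨x.2.val - 1, by omega⟩⟩ := by
    intro x
    apply (Module.AEval.of ℝ _ T).injective
    have h1 : Module.AEval.of ℝ _ T (A.mulVec (B x)) = (X : ℝ[X]) • Module.AEval.of ℝ _ T (B x) := by
      rw [← Module.AEval.of_aeval_smul, aeval_X]
      rfl
    have h2 : Module.AEval.of ℝ _ T (c x.1 • B x)
        = (C (c x.1) : ℝ[X]) • Module.AEval.of ℝ _ T (B x) := by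
      rw [← Module.AEval.of_aeval_smul, aeval_C]
      rfl
    rw [map_add, h1, h2, hB, ← map_smul, ← map_smul, hb, map_add, map_add, map_smul, map_smul]
    congr 1
    split_ifs with h
    · simp
    · rw [hB]
  exact ⟨ι, inferInstance, e, c, B, key⟩

/-- Every real square matrix with real spectrum has a Jordan form. -/
theorem nonempty_jordanForm {k : ℕ} (A : Matrix (Fin k) (Fin k) ℝ) (hA : A.charpoly.Splits) :
    Nonempty (JordanForm A) := by
  classical
  obtain ⟨ι, _, size, eig, b, hb⟩ := exists_jordan_basis A hA
  let κ := {i : ι // 0 < size i}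
  let f : Fin (Fintype.card κ) ≃ κ := (Fintype.equivFin κ).symm
  let size' : Fin (Fintype.card κ) → ℕ := fun i => size (f i).1
  let g : (Σ i, Fin (size' i)) ≃ Σ i, Fin (size i) :=
    { toFun := fun x => ⟨(f x.1).1, x.2⟩
      invFun := fun x => ⟨f.symm ⟨x.1, x.2.pos⟩, Fin.cast (by simp [size']) x.2⟩
      left_inv := by
        rintro ⟨i, j⟩
        have h1 : f.symm ⟨(f i).1, j.pos⟩ = i := f.symm_apply_apply i
        ext
        · exact congrArg Fin.val h1
        · refine (Fin.heq_ext_iff ?_).2 rfl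
          simp [size']
      right_inv := by
        rintro ⟨i, j⟩
        have h1 : (f (f.symm ⟨i, j.pos⟩)).1 = i := by rw [f.apply_symm_apply]
        refine Sigma.ext h1 ((Fin.heq_ext_iff ?_).2 rfl)
        simp }
  let b' := b.reindex g.symm
  have hb' : ∀ x : Σ i, Fin (size' i), A.mulVec (b' x) = eig (f x.1).1 • b' x +
        if h : x.2.val = 0 then 0 else b' ⟨x.1, ⟨x.2.val - 1, by omega⟩⟩ := by
    intro x
    simp only [b', Module.Basis.reindex_apply, Equiv.symm_symm]
    exact hb (g x)
  have hAZ : A * (Pi.basisFun ℝ (Fin k)).toMatrix b' = (Pi.basisFun ℝ (Fin k)).toMatrix b' *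
      Matrix.blockDiagonal' (fun i => jordanBlock (size' i) (eig (f i).1)) := by
    ext i ⟨x, j⟩
    have h1 := congrFun (hb' ⟨x, j⟩) i
    rw [Matrix.mul_apply, Matrix.mul_apply, Fintype.sum_sigma, Finset.sum_eq_single x]
    · have h2 : ∀ a : Fin (size' x), (Pi.basisFun ℝ (Fin k)).toMatrix b' i ⟨x, a⟩ = b' ⟨x, a⟩ i :=
        fun a => rfl
      have h3 : ∑ l, A i l * (Pi.basisFun ℝ (Fin k)).toMatrix b' l ⟨x, j⟩
        = A.mulVec (b' ⟨x, j⟩) i := rfl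
      rw [h3, h1]
      simp only [h2, Matrix.blockDiagonal'_apply_eq, jordanBlock, Matrix.of_apply]
      have h4 : ∀ a : Fin (size' x), b' ⟨x, a⟩ i *
          (if a = j then eig (f x).1 else if a.val + 1 = j.val then 1 else 0)
          = (if a = j then eig (f x).1 * b' ⟨x, j⟩ i else 0) +
            if a.val + 1 = j.val then b' ⟨x, a⟩ i else 0 := by
        intro a
        by_cases h : a = j
        · subst h; simp [mul_comm]
        · simp [h]
      simp only [h4, Finset.sum_add_distrib, Finset.sum_ite_eq', Finset.mem_univ, if_true,
        Pi.add_apply, Pi.smul_apply, smul_eq_mul]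
      congr 1
      split_ifs with h
      · rw [Finset.sum_eq_zero]
        · rfl
        · intro a _
          rw [if_neg (by omega)]
      · rw [Finset.sum_eq_single (⟨j.val - 1, by omega⟩ : Fin (size' x))]
        · rw [if_pos (Nat.sub_add_cancel (Nat.pos_of_ne_zero h))]
        · intro a _ ha
          rw [if_neg]
          intro h'
          exact ha (Fin.ext (by simp only; omega))
        · simp
    · intro y _ hy
      refine Finset.sum_eq_zero fun a _ => ?_
      rw [Matrix.blockDiagonal'_apply_ne _ _ _ hy, mul_zero]
    · simp
  refine ⟨⟨_, size', fun i => (f i).2, fun i => eig (f i).1, b'.toMatrix (Pi.basisFun ℝ (Fin k)),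
    (Pi.basisFun ℝ (Fin k)).toMatrix b', ?_, ?_, ?_⟩⟩
  · exact Module.Basis.toMatrix_mul_toMatrix_flip _ _
  · exact Module.Basis.toMatrix_mul_toMatrix_flip _ _
  · rw [← hAZ, Matrix.mul_assoc, Module.Basis.toMatrix_mul_toMatrix_flip, Matrix.mul_one]

end

end ChebMatrix

open Polynomial MeasureTheory Set
open scoped Real Topology

namespace ChebMatrix

/-! ### Chebyshev coefficients of absolutely continuous functions -/

/-! A norming functional reduces the matrix estimate to a scalar one. For fixed `N`, Hahn-Banach
(`exists_linearMap_eq_seminorm`) gives a linear `φ` with `|φ| ≤ ν` that attains `ν` at the error.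
With `c n` the image under `φ` of the `n`-th term of the expansion of `f(A)`, the error has size
`-∑_{n>N} c n`, while the scalar series `g(t) = ∑ c n T_n^(ℓ+1)(t)` equals `φ (G t)`, so `|g| ≤ ν (G
t)` pointwise. No dimension constant can enter.

The scalar tail is controlled by the L¹ norm of `g`. Integration by parts gives `α_n[h] =
(α_{n-1}[h'] - α_{n+1}[h']) / (2n)`. Iterating it yields kernels `sinKernel ℓ n`, of size at most
`(2/π) (n-ℓ)^(-ℓ-1)`, that recover a Chebyshev coefficient from the derivative of order `ℓ+1`.
Applied termwise to `g` and combined with orthogonality, they give `c n`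
(`coeff_eq_integral_of_summable`). Summing over `n > N` produces `1 / (ℓ (N-ℓ)^ℓ)`
(`abs_tsum_tail_le`).

Convergence is a count of powers of `n`. With `r = 2m+2ℓ` the coefficients are `O(n^(-r-2))`:
bounded variation gives `O(1/n)`, and each of `r+1` integrations gains one power
(`SmoothBV.exists_chebCoeff_bound`). The entries of `T_n(A)` are `O(n^(2m-2))`, because a block of
order at most `m` involves derivatives of `T_n` up to order `m-1`, each costing `n²`. Finally
`T_n^(ℓ+1)` is `O(n^(2ℓ+2))`, so the terms of `G` are `O(n^(-2))`. That the expansion sums to `f(A)`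
is termwise differentiation of the scalar series at the eigenvalues (`JordanForm.hasSum_matFun`). -/

theorem eval_chebT_eq_cos (n : ℕ) {x : ℝ} (hx : x ∈ Icc (-1 : ℝ) 1) :
    (chebT n).eval x = Real.cos (n * Real.arccos x) := by
  have h := Polynomial.Chebyshev.T_real_cos (Real.arccos x) (n : ℤ)
  rw [Real.cos_arccos hx.1 hx.2] at h
  simpa [chebT] using h

theorem abs_eval_chebT_le_one (n : ℕ) {x : ℝ} (hx : x ∈ Icc (-1 : ℝ) 1) :
    |(chebT n).eval x| ≤ 1 := by
  rw [eval_chebT_eq_cos n hx]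
  exact Real.abs_cos_le_one _

theorem intervalIntegrable_inv_sqrt :
    IntervalIntegrable (fun t : ℝ => (√(1 - t ^ 2))⁻¹) volume (-1) 1 := by
  simpa using Polynomial.Chebyshev.intervalIntegrable_sqrt_one_sub_sq_inv

theorem uIcc_neg_one_one : uIcc (-1 : ℝ) 1 = Icc (-1) 1 := uIcc_of_le (by norm_num)

theorem intervalIntegrable_mul_div_sqrt {w : ℝ → ℝ} {C : ℝ}
    (hw : IntervalIntegrable w volume (-1) 1) (hC : ∀ x ∈ Icc (-1 : ℝ) 1, |w x| ≤ C)
    {g : ℝ → ℝ} (hg : ContinuousOn g (Icc (-1) 1)) :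
    IntervalIntegrable (fun t => w t * g t / √(1 - t ^ 2)) volume (-1) 1 := by
  have h1 : IntervalIntegrable (fun t => g t * (√(1 - t ^ 2))⁻¹) volume (-1) 1 :=
    intervalIntegrable_inv_sqrt.continuousOn_mul (by rwa [uIcc_neg_one_one])
  have h2 : IntervalIntegrable (fun t => w t * (g t * (√(1 - t ^ 2))⁻¹)) volume (-1) 1 := by
    rw [intervalIntegrable_iff_integrableOn_Ioc_of_le (by norm_num)] at *
    refine Integrable.bdd_mul (c := C) h1 hw.aestronglyMeasurable ?_
    refine (ae_restrict_iff' measurableSet_Ioc).2 (ae_of_all _ fun x hx => ?_)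
    exact hC x (Ioc_subset_Icc_self hx)
  simpa only [div_eq_mul_inv, mul_assoc] using h2

theorem intervalIntegrable_div_sqrt {g : ℝ → ℝ} (hg : ContinuousOn g (Icc (-1) 1)) :
    IntervalIntegrable (fun t => g t / √(1 - t ^ 2)) volume (-1) 1 :=
  intervalIntegrable_inv_sqrt.continuousOn_mul (by rwa [uIcc_neg_one_one])

theorem hasDerivAt_sin_mul_arccos (n : ℕ) {x : ℝ} (hx : x ∈ Ioo (-1 : ℝ) 1) :
    HasDerivAt (fun t => Real.sin (n * Real.arccos t))
      (-(n * ((chebT n).eval x / √(1 - x ^ 2)))) x := by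
  have h := ((Real.hasDerivAt_arccos hx.1.ne' hx.2.ne).const_mul (n : ℝ)).sin
  convert h using 1
  rw [eval_chebT_eq_cos n (Ioo_subset_Icc_self hx)]
  ring

theorem integral_chebT_div_sqrt (n : ℕ) {a b : ℝ} (ha : -1 ≤ a) (hab : a ≤ b) (hb : b ≤ 1) :
    ∫ t in a..b, -(n * ((chebT n).eval t / √(1 - t ^ 2))) =
      Real.sin (n * Real.arccos b) - Real.sin (n * Real.arccos a) := by
  refine intervalIntegral.integral_eq_sub_of_hasDerivAt_of_le
    (f := fun t => Real.sin (n * Real.arccos t)) hab ?_ ?_ ?_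
  · exact (Real.continuous_sin.comp (continuous_const.mul Real.continuous_arccos)).continuousOn
  · exact fun x hx => hasDerivAt_sin_mul_arccos n ⟨ha.trans_lt hx.1, hx.2.trans_le hb⟩
  · have h := ((intervalIntegrable_div_sqrt
      (chebT n).continuous.continuousOn).const_mul (n : ℝ)).neg
    refine h.mono_set ?_
    rw [uIcc_neg_one_one, uIcc_of_le hab]
    exact Icc_subset_Icc ha hb

/-- Integration by parts in the Chebyshev coefficient. -/
theorem chebCoeff_eq_integral_deriv {h : ℝ → ℝ} (hh : AbsolutelyContinuousOnInterval h (-1) 1)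
    {n : ℕ} (hn : n ≠ 0) :
    chebCoeff h n = 2 / (π * n) * ∫ t in (-1 : ℝ)..1, deriv h t * Real.sin (n * Real.arccos t) := by
  have hn' : (n : ℝ) ≠ 0 := Nat.cast_ne_zero.2 hn
  set s : ℝ → ℝ := fun t => -(n * ((chebT n).eval t / √(1 - t ^ 2))) with hs
  -- The derivative of `sin (n arccos t)` is unbounded near `±1`. Writing that function as the
  -- primitive of an integrable function makes its absolute continuity immediate.
  set S : ℝ → ℝ := fun x => ∫ t in (-1 : ℝ)..x, s t with hS
  have hint : IntervalIntegrable s volume (-1) 1 :=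
    ((intervalIntegrable_div_sqrt (chebT n).continuous.continuousOn).const_mul (n : ℝ)).neg
  have hSac : AbsolutelyContinuousOnInterval S (-1) 1 :=
    hint.absolutelyContinuousOnInterval_intervalIntegral (by simp)
  have hSeq : ∀ x ∈ Icc (-1 : ℝ) 1, S x = Real.sin (n * Real.arccos x) := by
    intro x hx
    have h1 := integral_chebT_div_sqrt n le_rfl hx.1 hx.2
    rw [Real.arccos_neg_one, Real.sin_nat_mul_pi, sub_zero] at h1
    exact h1
  have hSd : ∀ x ∈ Ioo (-1 : ℝ) 1, deriv S x = s x := by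
    intro x hx
    refine ((hasDerivAt_sin_mul_arccos n hx).congr_of_eventuallyEq ?_).deriv
    filter_upwards [Ioo_mem_nhds hx.1 hx.2] with y hy using hSeq y (Ioo_subset_Icc_self hy)
  have key := hh.integral_mul_deriv_eq_deriv_mul hSac
  rw [hSeq 1 (by simp), hSeq (-1) (by simp), Real.arccos_neg_one, Real.sin_nat_mul_pi,
    Real.arccos_one] at key
  have h1 : ∫ t in (-1 : ℝ)..1, h t * deriv S t =
      ∫ t in (-1 : ℝ)..1, -(n : ℝ) * (h t * (chebT n).eval t / √(1 - t ^ 2)) := by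
    refine intervalIntegral.integral_congr_uIoo fun t ht => ?_
    rw [uIoo_of_le (by norm_num)] at ht
    simp only [hSd t ht, hs]
    ring
  have h2 : ∫ t in (-1 : ℝ)..1, deriv h t * S t =
      ∫ t in (-1 : ℝ)..1, deriv h t * Real.sin (n * Real.arccos t) := by
    refine intervalIntegral.integral_congr fun t ht => ?_
    rw [uIcc_neg_one_one] at ht
    simp only [hSeq t ht]
  rw [h1, h2, intervalIntegral.integral_const_mul] at key
  simp only [mul_zero, Real.sin_zero, sub_zero, zero_sub, neg_mul, neg_inj] at key
  rw [chebCoeff, ← key]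
  field_simp

/-- With `t = cos θ` this is `2 sin((n+1)θ) sin θ = cos(nθ) - cos((n+2)θ)`, where `sin θ = √(1 -
t²)`. -/
theorem sin_mul_arccos_eq (n : ℕ) {t : ℝ} (ht : t ∈ Ioo (-1 : ℝ) 1) :
    Real.sin ((n + 1 : ℕ) * Real.arccos t) =
      ((chebT n).eval t / √(1 - t ^ 2) - (chebT (n + 2)).eval t / √(1 - t ^ 2)) / 2 := by
  have hpos : 0 < √(1 - t ^ 2) := Real.sqrt_pos.2 (by nlinarith [ht.1, ht.2])
  rw [eval_chebT_eq_cos _ (Ioo_subset_Icc_self ht), eval_chebT_eq_cos _ (Ioo_subset_Icc_self ht)]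
  have h1 : (n : ℝ) * Real.arccos t = (n + 1 : ℕ) * Real.arccos t - Real.arccos t := by
    push_cast; ring
  have h2 : ((n + 2 : ℕ) : ℝ) * Real.arccos t = (n + 1 : ℕ) * Real.arccos t + Real.arccos t := by
    push_cast; ring
  rw [h1, h2, Real.cos_sub, Real.cos_add, Real.sin_arccos]
  field_simp
  ring

/-- The recursion between the Chebyshev coefficients of a function and of its derivative. -/
theorem chebCoeff_succ_eq {h w : ℝ → ℝ} (hh : AbsolutelyContinuousOnInterval h (-1) 1)
    (hd : ∀ᵐ x : ℝ, x ∈ Ioo (-1 : ℝ) 1 → HasDerivAt h (w x) x) {C : ℝ}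
    (hw : IntervalIntegrable w volume (-1) 1) (hC : ∀ x ∈ Icc (-1 : ℝ) 1, |w x| ≤ C) (n : ℕ) :
    chebCoeff h (n + 1) = (chebCoeff w n - chebCoeff w (n + 2)) / (2 * ((n : ℝ) + 1)) := by
  rw [chebCoeff_eq_integral_deriv hh n.succ_ne_zero]
  have h1 : ∫ t in (-1 : ℝ)..1, deriv h t * Real.sin ((n + 1 : ℕ) * Real.arccos t) =
      ∫ t in (-1 : ℝ)..1, 1 / 2 * (w t * (chebT n).eval t / √(1 - t ^ 2) -
        w t * (chebT (n + 2)).eval t / √(1 - t ^ 2)) := by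
    refine intervalIntegral.integral_congr_ae ?_
    -- The integral runs over a half-open interval containing `1`, where neither the derivative nor
    -- the trigonometric identity is available.
    have hne : ∀ᵐ x : ℝ, x ≠ 1 := by simp [ae_iff, measure_singleton]
    filter_upwards [hd, hne] with t ht ht1 htm
    rw [uIoc_of_le (by norm_num)] at htm
    have htm' : t ∈ Ioo (-1 : ℝ) 1 := ⟨htm.1, lt_of_le_of_ne htm.2 ht1⟩
    rw [(ht htm').deriv, sin_mul_arccos_eq n htm']
    ring
  rw [h1, intervalIntegral.integral_const_mul, intervalIntegral.integral_sub
    (intervalIntegrable_mul_div_sqrt hw hC (chebT n).continuous.continuousOn)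
    (intervalIntegrable_mul_div_sqrt hw hC (chebT (n + 2)).continuous.continuousOn)]
  simp only [chebCoeff]
  push_cast
  field_simp

/-! ### Decay of the Chebyshev coefficients -/

/-- Cut the interval at the zeros of `sin (n arccos t)`. On each piece `T_n(t)/√(1-t²)` has integral
zero, so `p` may be replaced by its increment from the left end. The weight of a piece is `π/n`, and
the increments of `p` telescope. -/
theorem abs_chebCoeff_le_of_monotoneOn {p : ℝ → ℝ} (hp : MonotoneOn p (Icc (-1) 1)) {n : ℕ}
    (hn : n ≠ 0) : |chebCoeff p n| ≤ 2 * (p 1 - p (-1)) / n := by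
  have hn0 : (0 : ℝ) < n := Nat.cast_pos.2 (Nat.pos_of_ne_zero hn)
  have hp1 : ∀ x ∈ Icc (-1 : ℝ) 1, |p x| ≤ max |p 1| |p (-1)| := fun x hx =>
    abs_le_max_abs_abs (hp (by simp) hx hx.1) (hp hx (by simp) hx.2) |>.trans_eq (max_comm _ _)
  set g : ℝ → ℝ := fun t => p t * (chebT n).eval t / √(1 - t ^ 2) with hg
  have hgint : IntervalIntegrable g volume (-1) 1 :=
    intervalIntegrable_mul_div_sqrt (MonotoneOn.intervalIntegrable (by rwa [uIcc_neg_one_one]))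
      hp1 (chebT n).continuous.continuousOn
  -- The angle is reversed so that the nodes increase from `-1` to `1`.
  set x : ℕ → ℝ := fun j => Real.cos (π - j * π / n) with hx
  have hang : ∀ j ≤ n, π - j * π / n ∈ Icc 0 π := by
    intro j hj
    have hj' : (j : ℝ) ≤ n := Nat.cast_le.2 hj
    have : (j : ℝ) * π / n ≤ π := by
      rw [div_le_iff₀ hn0, mul_comm]
      exact mul_le_mul_of_nonneg_left hj' Real.pi_pos.le
    exact ⟨by linarith, by have : 0 ≤ (j : ℝ) * π / n := by positivity
                           linarith⟩
  have harc : ∀ j ≤ n, Real.arccos (x j) = π - j * π / n := fun j hj =>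
    Real.arccos_cos (hang j hj).1 (hang j hj).2
  have hxm : ∀ j, x j ∈ Icc (-1 : ℝ) 1 := fun j => ⟨Real.neg_one_le_cos _, Real.cos_le_one _⟩
  have hsin : ∀ j ≤ n, Real.sin (n * Real.arccos (x j)) = 0 := by
    intro j hj
    rw [harc j hj]
    have : (n : ℝ) * (π - j * π / n) = ((n : ℤ) - (j : ℤ) : ℤ) * π := by
      push_cast; field_simp
    rw [this, Real.sin_int_mul_pi]
  have hmono : ∀ j < n, x j ≤ x (j + 1) := by
    intro j hj
    refine Real.cos_le_cos_of_nonneg_of_le_pi (hang _ hj).1 (hang j hj.le).2 ?_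
    have : (j : ℝ) * π / n ≤ ((j + 1 : ℕ) : ℝ) * π / n := by
      gcongr; simp
    linarith
  have hsub : ∀ j < n, IntervalIntegrable g volume (x j) (x (j + 1)) := fun j hj =>
    hgint.mono_set (by
      rw [uIcc_neg_one_one, uIcc_of_le (hmono j hj)]
      exact Icc_subset_Icc (hxm j).1 (hxm _).2)
  have hpiece : ∀ j < n, |∫ t in x j..x (j + 1), g t| ≤ (p (x (j + 1)) - p (x j)) * (π / n) := by
    intro j hj
    have hss : Icc (x j) (x (j + 1)) ⊆ Icc (-1 : ℝ) 1 := Icc_subset_Icc (hxm j).1 (hxm _).2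
    have hun : uIcc (x j) (x (j + 1)) ⊆ uIcc (-1 : ℝ) 1 := by
      rwa [uIcc_neg_one_one, uIcc_of_le (hmono j hj)]
    have hT : IntervalIntegrable (fun t => (chebT n).eval t / √(1 - t ^ 2)) volume
        (x j) (x (j + 1)) :=
      (intervalIntegrable_div_sqrt (chebT n).continuous.continuousOn).mono_set hun
    have hz : ∫ t in x j..x (j + 1), (chebT n).eval t / √(1 - t ^ 2) = 0 := by
      have h1 := integral_chebT_div_sqrt n (hxm j).1 (hmono j hj) (hxm (j + 1)).2
      rw [hsin j hj.le, hsin (j + 1) hj, intervalIntegral.integral_neg,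
        intervalIntegral.integral_const_mul] at h1
      have h2 : (n : ℝ) * ∫ t in x j..x (j + 1), (chebT n).eval t / √(1 - t ^ 2) = 0 := by linarith
      exact (mul_eq_zero.1 h2).resolve_left hn0.ne'
    have h1 : ∫ t in x j..x (j + 1), g t =
        ∫ t in x j..x (j + 1), (g t - p (x j) * ((chebT n).eval t / √(1 - t ^ 2))) := by
      rw [intervalIntegral.integral_sub (hsub j hj) (hT.const_mul _),
        intervalIntegral.integral_const_mul, hz, mul_zero, sub_zero]
    have hI : ∫ t in x j..x (j + 1), (√(1 - t ^ 2))⁻¹ = π / n := by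
      have := intervalIntegral.integral_eq_sub_of_hasDerivAt_of_le
        (f := fun t => -Real.arccos t) (f' := fun t => (√(1 - t ^ 2))⁻¹) (hmono j hj)
        Real.continuous_arccos.neg.continuousOn (fun y hy => by
          have := (Real.hasDerivAt_arccos ((hxm j).1.trans_lt hy.1).ne'
            (hy.2.trans_le (hxm (j + 1)).2).ne).neg
          simpa using! this) (intervalIntegrable_inv_sqrt.mono_set hun)
      rw [this, harc j hj.le, harc (j + 1) hj]
      push_cast
      field_simp
      ring
    rw [h1, ← Real.norm_eq_abs]
    refine (intervalIntegral.norm_integral_le_of_norm_le (hmono j hj)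
      (g := fun t => (p (x (j + 1)) - p (x j)) * (√(1 - t ^ 2))⁻¹) (ae_of_all _ fun t ht => ?_)
      ((intervalIntegrable_inv_sqrt.mono_set hun).const_mul _)).trans_eq ?_
    · have htI : t ∈ Icc (-1 : ℝ) 1 := hss (Ioc_subset_Icc_self ht)
      have e : g t - p (x j) * ((chebT n).eval t / √(1 - t ^ 2)) =
          (p t - p (x j)) * (chebT n).eval t * (√(1 - t ^ 2))⁻¹ := by
        simp only [hg]; ring
      have h3 : 0 ≤ p t - p (x j) := sub_nonneg.2 (hp (hxm j) htI ht.1.le)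
      have h4 : p t ≤ p (x (j + 1)) := hp htI (hxm _) ht.2
      rw [e, Real.norm_eq_abs, abs_mul, abs_mul, abs_of_nonneg h3,
        abs_of_nonneg (inv_nonneg.2 (Real.sqrt_nonneg (1 - t ^ 2)))]
      refine mul_le_mul_of_nonneg_right ?_ (inv_nonneg.2 (Real.sqrt_nonneg _))
      have := mul_le_mul_of_nonneg_left (abs_eval_chebT_le_one n htI) h3
      linarith
    · rw [intervalIntegral.integral_const_mul, hI]
  have hsum := intervalIntegral.sum_integral_adjacent_intervals (a := x) (n := n) hsub
  have hx0 : x 0 = -1 := by simp [hx]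
  have hxn : x n = 1 := by
    simp only [hx]
    rw [mul_div_assoc, mul_div_cancel₀ _ hn0.ne', sub_self, Real.cos_zero]
  have htot : |∫ t in (-1 : ℝ)..1, g t| ≤ (p 1 - p (-1)) * (π / n) := by
    rw [← hx0, ← hxn, ← hsum]
    refine (Finset.abs_sum_le_sum_abs _ _).trans ((Finset.sum_le_sum fun j hj =>
      hpiece j (Finset.mem_range.1 hj)).trans_eq ?_)
    rw [← Finset.sum_mul, Finset.sum_range_sub (fun j => p (x j))]
  rw [chebCoeff, abs_mul, abs_of_pos (by positivity : (0 : ℝ) < 2 / π)]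
  refine (mul_le_mul_of_nonneg_left htot (by positivity)).trans_eq ?_
  field_simp

theorem BoundedVariationOn.exists_monotoneOn_sub {w : ℝ → ℝ}
    (hw : BoundedVariationOn w (Icc (-1) 1)) :
    ∃ p q : ℝ → ℝ, MonotoneOn p (Icc (-1) 1) ∧ MonotoneOn q (Icc (-1) 1) ∧ w = p - q :=
  hw.locallyBoundedVariationOn.exists_monotoneOn_sub_monotoneOn

theorem exists_chebCoeff_bound_of_boundedVariationOn {w : ℝ → ℝ}
    (hw : BoundedVariationOn w (Icc (-1) 1)) :
    ∃ K, ∀ n, |chebCoeff w n| * ((n : ℝ) + 1) ≤ K := by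
  obtain ⟨p, q, hp, hq, rfl⟩ := BoundedVariationOn.exists_monotoneOn_sub hw
  have hint : ∀ {p : ℝ → ℝ}, MonotoneOn p (Icc (-1) 1) → ∀ n, IntervalIntegrable
      (fun t => p t * (chebT n).eval t / √(1 - t ^ 2)) volume (-1) 1 := fun {p} hp n =>
    intervalIntegrable_mul_div_sqrt (C := max |p (-1)| |p 1|)
      (MonotoneOn.intervalIntegrable (by rwa [uIcc_neg_one_one]))
      (fun x hx => abs_le_max_abs_abs (hp (by simp) hx hx.1) (hp hx (by simp) hx.2))
      (chebT n).continuous.continuousOn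
  have hsub : ∀ n, chebCoeff (p - q) n = chebCoeff p n - chebCoeff q n := by
    intro n
    simp only [chebCoeff]
    rw [← mul_sub, ← intervalIntegral.integral_sub (hint hp n) (hint hq n)]
    congr 1
    refine intervalIntegral.integral_congr fun t _ => ?_
    simp only [Pi.sub_apply]
    ring
  set V := 2 * (p 1 - p (-1)) + 2 * (q 1 - q (-1)) with hV
  have hV0 : 0 ≤ V := by
    have h1 := hp (by simp : (-1 : ℝ) ∈ Icc (-1 : ℝ) 1) (by simp : (1 : ℝ) ∈ _) (by norm_num)
    have h2 := hq (by simp : (-1 : ℝ) ∈ Icc (-1 : ℝ) 1) (by simp : (1 : ℝ) ∈ _) (by norm_num)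
    linarith
  refine ⟨max |chebCoeff (p - q) 0| (2 * V), fun n => ?_⟩
  rcases Nat.eq_zero_or_pos n with rfl | hn
  · simp
  refine le_max_of_le_right ?_
  have hn1 : (1 : ℝ) ≤ n := Nat.one_le_cast.2 hn
  have h : |chebCoeff (p - q) n| ≤ V / n := by
    rw [hsub, hV, add_div]
    exact (abs_sub _ _).trans (add_le_add (abs_chebCoeff_le_of_monotoneOn hp hn.ne')
      (abs_chebCoeff_le_of_monotoneOn hq hn.ne'))
  calc |chebCoeff (p - q) n| * ((n : ℝ) + 1) ≤ V / n * (n + n) := by gcongr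
    _ = 2 * V := by field_simp; ring

/-- One integration gains one order of decay of the Chebyshev coefficients. -/
theorem exists_chebCoeff_bound_succ {h w : ℝ → ℝ}
    (hr : ∀ n, chebCoeff h (n + 1) = (chebCoeff w n - chebCoeff w (n + 2)) / (2 * ((n : ℝ) + 1)))
    {s : ℕ} (hw : ∃ K, ∀ n, |chebCoeff w n| * ((n : ℝ) + 1) ^ s ≤ K) :
    ∃ K, ∀ n, |chebCoeff h n| * ((n : ℝ) + 1) ^ (s + 1) ≤ K := by
  obtain ⟨K, hK⟩ := hw
  refine ⟨max |chebCoeff h 0| (K * 2 ^ (s + 1)), fun n => ?_⟩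
  rcases n with _ | n
  · simp
  refine le_max_of_le_right ?_
  have hK0 : 0 ≤ K := (by positivity : 0 ≤ |chebCoeff w 0| * (((0 : ℕ) : ℝ) + 1) ^ s).trans (hK 0)
  have hn : (0 : ℝ) < (n : ℝ) + 1 := by positivity
  have h1 : |chebCoeff w n| ≤ K / ((n : ℝ) + 1) ^ s := (le_div_iff₀ (by positivity)).2 (hK n)
  have h2 : |chebCoeff w (n + 2)| ≤ K / ((n : ℝ) + 1) ^ s := by
    refine (le_div_iff₀ (by positivity)).2 (le_trans ?_ (hK (n + 2)))
    gcongr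
    linarith
  have h3 : |chebCoeff h (n + 1)| ≤ K / ((n : ℝ) + 1) ^ (s + 1) := by
    rw [hr, abs_div, abs_of_pos (by positivity : (0 : ℝ) < 2 * ((n : ℝ) + 1))]
    rw [div_le_iff₀ (by positivity)]
    refine (abs_sub _ _).trans ((add_le_add h1 h2).trans_eq ?_)
    rw [pow_succ]
    field_simp
    ring
  -- The factor `2^(s+1)` pays for the index shift, through `n + 2 ≤ 2 (n + 1)`.
  calc |chebCoeff h (n + 1)| * (((n + 1 : ℕ) : ℝ) + 1) ^ (s + 1)
      ≤ K / ((n : ℝ) + 1) ^ (s + 1) * (2 * ((n : ℝ) + 1)) ^ (s + 1) := by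
        gcongr
        push_cast
        linarith [(Nat.cast_nonneg n : (0 : ℝ) ≤ n)]
    _ = K * 2 ^ (s + 1) := by rw [mul_pow]; field_simp

theorem uniqueDiffOn_Icc_neg_one_one : UniqueDiffOn ℝ (Icc (-1 : ℝ) 1) :=
  uniqueDiffOn_Icc (by norm_num)

theorem continuousOn_derivI {r : ℕ} {f : ℝ → ℝ} (hf : ContDiffOn ℝ r f (Icc (-1) 1)) {j : ℕ}
    (hj : j ≤ r) : ContinuousOn (derivI j f) (Icc (-1) 1) :=
  hf.continuousOn_iteratedDerivWithin (by exact_mod_cast hj) uniqueDiffOn_Icc_neg_one_one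

theorem hasDerivAt_derivI {r : ℕ} {f : ℝ → ℝ} (hf : ContDiffOn ℝ r f (Icc (-1) 1)) {j : ℕ}
    (hj : j < r) {x : ℝ} (hx : x ∈ Ioo (-1 : ℝ) 1) :
    HasDerivAt (derivI j f) (derivI (j + 1) f x) x := by
  have h1 := (hf.differentiableOn_iteratedDerivWithin (by exact_mod_cast hj)
    uniqueDiffOn_Icc_neg_one_one) x (Ioo_subset_Icc_self hx)
  have h2 := h1.hasDerivWithinAt.hasDerivAt (Icc_mem_nhds hx.1 hx.2)
  rwa [← iteratedDerivWithin_succ] at h2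

theorem absolutelyContinuousOnInterval_derivI {r : ℕ} {f : ℝ → ℝ}
    (hf : ContDiffOn ℝ r f (Icc (-1) 1)) {j : ℕ} (hj : j < r) :
    AbsolutelyContinuousOnInterval (derivI j f) (-1) 1 := by
  apply ContDiffOn.absolutelyContinuousOnInterval
  rw [uIcc_neg_one_one]
  exact (contDiffOn_nat_succ_iff_contDiffOn_one_iteratedDerivWithin
    uniqueDiffOn_Icc_neg_one_one).1 (hf.of_le (by exact_mod_cast hj)) |>.2

/-- The Chebyshev coefficients of a function whose `(r+1)`-st derivative is of bounded
variation are `O(n^(-r-2))`. -/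
theorem SmoothBV.exists_chebCoeff_bound {r : ℕ} {f : ℝ → ℝ} (hf : SmoothBV r f) :
    ∃ K, ∀ n, |chebCoeff f n| * ((n : ℝ) + 1) ^ (r + 2) ≤ K := by
  obtain ⟨hf1, hf2, w, hw, hd⟩ := hf
  -- Induction from the top derivative downwards: `i` counts the integrations performed after
  -- reaching `f^(r)`, which itself lies one integration above `w`.
  have hmain : ∀ i ≤ r, ∃ K, ∀ n, |chebCoeff (derivI (r - i) f) n| * ((n : ℝ) + 1) ^ (i + 2) ≤ K := by
    intro i
    induction i with
    | zero =>
      intro _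
      obtain ⟨p, q, hp, hq, hpq⟩ := BoundedVariationOn.exists_monotoneOn_sub hw
      have hwi : IntervalIntegrable w volume (-1) 1 := by
        rw [hpq]
        exact (MonotoneOn.intervalIntegrable (by rwa [uIcc_neg_one_one])).sub
          (MonotoneOn.intervalIntegrable (by rwa [uIcc_neg_one_one]))
      have hwb : ∀ x ∈ Icc (-1 : ℝ) 1, |w x| ≤ max |p (-1)| |p 1| + max |q (-1)| |q 1| := by
        intro x hx
        rw [hpq]
        exact (abs_sub _ _).trans (add_le_add
          (abs_le_max_abs_abs (hp (by simp) hx hx.1) (hp hx (by simp) hx.2))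
          (abs_le_max_abs_abs (hq (by simp) hx hx.1) (hq hx (by simp) hx.2)))
      refine exists_chebCoeff_bound_succ (chebCoeff_succ_eq hf2 hd hwi hwb) ?_
      simpa using exists_chebCoeff_bound_of_boundedVariationOn hw
    | succ i ih =>
      intro hi
      have hlt : r - (i + 1) < r := by omega
      have hs : r - (i + 1) + 1 = r - i := by omega
      have hc := continuousOn_derivI hf1 (Nat.sub_le r i)
      obtain ⟨C, hC⟩ := isCompact_Icc.exists_bound_of_continuousOn hc
      refine exists_chebCoeff_bound_succ (chebCoeff_succ_eq (C := C)
        (absolutelyContinuousOnInterval_derivI hf1 hlt) (ae_of_all _ fun x hx => ?_) ?_ hC)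
        (ih (by omega))
      · rw [← hs]
        exact hasDerivAt_derivI hf1 hlt hx
      · exact ContinuousOn.intervalIntegrable (by rwa [uIcc_neg_one_one])
  have h := hmain r le_rfl
  rwa [Nat.sub_self, show derivI 0 f = f from iteratedDerivWithin_zero] at h

/-! ### Derivatives of Chebyshev polynomials on `[-1, 1]` -/

/-- Derivatives of `T_n` are largest at `1`, where `(2j+1) T_n^(j+1)(1) = (n² - j²) T_n^(j)(1)`.
Each derivative therefore costs at most a factor `n²`. -/
theorem abs_eval_iterate_derivative_chebT_le (n j : ℕ) {x : ℝ} (hx : x ∈ Icc (-1 : ℝ) 1) :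
    |(derivative^[j] (chebT n)).eval x| ≤ (n : ℝ) ^ (2 * j) := by
  refine (Polynomial.Chebyshev.abs_iterate_derivative_T_real_le n j (abs_le.2 hx)).trans ?_
  have hnn : ∀ j : ℕ, 0 ≤ (derivative^[j] (Polynomial.Chebyshev.T ℝ (n : ℤ))).eval 1 := fun j =>
    (abs_nonneg _).trans (Polynomial.Chebyshev.abs_iterate_derivative_T_real_le n j
      (x := 1) (by simp))
  induction j with
  | zero => simp
  | succ j ih =>
    have h := Polynomial.Chebyshev.iterate_derivative_T_eval_one_recurrence (R := ℝ) (n : ℤ) j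
    push_cast at h
    set a := (derivative^[j + 1] (Polynomial.Chebyshev.T ℝ (n : ℤ))).eval 1
    set b := (derivative^[j] (Polynomial.Chebyshev.T ℝ (n : ℤ))).eval 1
    have ha : 0 ≤ a := hnn (j + 1)
    have hb : 0 ≤ b := hnn j
    have h1 : a ≤ (n : ℝ) ^ 2 * b := by
      have h2 : 0 ≤ (j : ℝ) * a := by positivity
      have h3 : 0 ≤ (j : ℝ) ^ 2 * b := by positivity
      nlinarith
    calc a ≤ (n : ℝ) ^ 2 * b := h1
      _ ≤ (n : ℝ) ^ 2 * (n : ℝ) ^ (2 * j) := by gcongr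
      _ = (n : ℝ) ^ (2 * (j + 1)) := by ring

/-! ### Kernels for the Chebyshev coefficients -/

theorem chebCoeff_eq_integral_measureT (f : ℝ → ℝ) (n : ℕ) :
    chebCoeff f n = 2 / π * ∫ t, f t * (chebT n).eval t ∂Polynomial.Chebyshev.measureT := by
  rw [Polynomial.Chebyshev.integral_measureT, chebCoeff]
  simp only [Real.sqrt_inv, div_eq_mul_inv]

theorem chebCoeff_chebT (k : ℕ) {n : ℕ} (hn : n ≠ 0) :
    chebCoeff (fun t => (chebT k).eval t) n = if k = n then 1 else 0 := by
  rw [chebCoeff_eq_integral_measureT]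
  split_ifs with h
  · subst h
    have := Polynomial.Chebyshev.integral_T_real_mul_self_measureT_of_ne_zero hn
    simp only [chebT]
    rw [this]
    field_simp
  · have := Polynomial.Chebyshev.integral_eval_T_real_mul_eval_T_real_measureT_of_ne h
    simp only [chebT]
    rw [this, mul_zero]

theorem contDiff_eval (p : ℝ[X]) {n : WithTop ℕ∞} : ContDiff ℝ n fun t => p.eval t :=  by
  have h := p.contDiff_aeval (𝕜 := ℝ) n
  simp only [coe_aeval_eq_eval] at h
  exact h

theorem chebCoeff_polynomial_succ (p : ℝ[X]) (n : ℕ) :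
    chebCoeff (fun t => p.eval t) (n + 1) =
      (chebCoeff (fun t => (derivative p).eval t) n -
        chebCoeff (fun t => (derivative p).eval t) (n + 2)) / (2 * ((n : ℝ) + 1)) := by
  obtain ⟨C, hC⟩ := isCompact_Icc.exists_bound_of_continuousOn
    ((derivative p).continuous.continuousOn (s := Icc (-1 : ℝ) 1))
  exact chebCoeff_succ_eq (contDiff_eval p).contDiffOn.absolutelyContinuousOnInterval
    (ae_of_all _ fun x _ => p.hasDerivAt x) ((derivative p).continuous.intervalIntegrable _ _) hC n

/-- The kernel which recovers the `n`-th Chebyshev coefficient from the derivative of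
order `j + 1`. -/
noncomputable def sinKernel : ℕ → ℕ → ℝ → ℝ
  | 0, n => fun t => 2 / (π * n) * Real.sin (n * Real.arccos t)
  -- Only orders `j` below `n` are used: then `n - 1` is a genuine subtraction and every index
  -- reached at the base is at least `1`.
  | j + 1, n => fun t => (sinKernel j (n - 1) t - sinKernel j (n + 1) t) / (2 * n)

theorem continuous_sinKernel (j n : ℕ) : Continuous (sinKernel j n) := by
  induction j generalizing n with
  | zero =>
    exact continuous_const.mul
      (Real.continuous_sin.comp (continuous_const.mul Real.continuous_arccos))
  | succ j ih => exact ((ih _).sub (ih _)).div_const _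

/-- Of the two kernels in the recursion the one of index `n - 1` has the worse bound. Its distance
to `j` equals that of `n` to `j + 1`, so the shape of the bound is preserved, and the divisor `2n`
supplies the new power. -/
theorem abs_sinKernel_le {j n : ℕ} (hn : j < n) (t : ℝ) :
    |sinKernel j n t| ≤ 2 / π / ((n : ℝ) - j) ^ (j + 1) := by
  induction j generalizing n with
  | zero =>
    have hn0 : (0 : ℝ) < n := Nat.cast_pos.2 hn
    simp only [sinKernel, abs_mul, Nat.cast_zero, sub_zero, zero_add, pow_one]
    rw [abs_of_pos (by positivity : 0 < 2 / (π * n)), div_div]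
    exact mul_le_of_le_one_right (by positivity) (Real.abs_sin_le_one _)
  | succ j ih =>
    obtain ⟨n, rfl⟩ : ∃ n', n = n' + 1 := ⟨n - 1, by omega⟩
    have hjn : j < n := by omega
    have hjn' : (j : ℝ) < n := Nat.cast_lt.2 hjn
    have hx : 0 < (n : ℝ) - j := sub_pos.2 hjn'
    have h1 := ih hjn
    have h2 : |sinKernel j (n + 2) t| ≤ 2 / π / ((n : ℝ) - j) ^ (j + 1) := by
      refine (ih (by omega : j < n + 2)).trans ?_
      gcongr
      simp
    have e : ((n + 1 : ℕ) : ℝ) - ((j + 1 : ℕ) : ℝ) = n - j := by push_cast; ring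
    have hle : (n : ℝ) - j ≤ (n + 1 : ℕ) := by
      push_cast
      linarith [(Nat.cast_nonneg j : (0 : ℝ) ≤ j)]
    have hpos : (0 : ℝ) < (n + 1 : ℕ) := by positivity
    simp only [sinKernel, Nat.add_sub_cancel]
    rw [e, abs_div, abs_of_pos (by positivity : (0 : ℝ) < 2 * (n + 1 : ℕ))]
    calc |sinKernel j n t - sinKernel j (n + 1 + 1) t| / (2 * (n + 1 : ℕ))
        ≤ (2 / π / ((n : ℝ) - j) ^ (j + 1) + 2 / π / ((n : ℝ) - j) ^ (j + 1)) /
            (2 * ((n : ℝ) - j)) := by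
          gcongr
          exact (abs_sub _ _).trans (add_le_add h1 h2)
      _ = 2 / π / ((n : ℝ) - j) ^ (j + 1 + 1) := by
          rw [pow_succ _ (j + 1)]
          field_simp
          ring

/-- This iterates the coefficient recursion. The condition `j < n` keeps the coefficient of index
`0` out of it, which no derivative determines. -/
theorem chebCoeff_polynomial_eq_integral (p : ℝ[X]) {j n : ℕ} (hn : j < n) :
    chebCoeff (fun t => p.eval t) n =
      ∫ t in (-1 : ℝ)..1, (derivative^[j + 1] p).eval t * sinKernel j n t := by
  induction j generalizing n p with
  | zero =>
    rw [chebCoeff_eq_integral_deriv (contDiff_eval p).contDiffOn.absolutelyContinuousOnInterval hn.ne',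
      ← intervalIntegral.integral_const_mul]
    refine intervalIntegral.integral_congr fun t _ => ?_
    simp only [sinKernel, Polynomial.deriv, zero_add, Function.iterate_one]
    ring
  | succ j ih =>
    obtain ⟨n, rfl⟩ : ∃ n', n = n' + 1 := ⟨n - 1, by omega⟩
    have hi : ∀ k, IntervalIntegrable
        (fun t => (derivative^[j + 1] (derivative p)).eval t * sinKernel j k t) volume (-1) 1 :=
      fun k => ((Polynomial.continuous _).mul (continuous_sinKernel _ _)).intervalIntegrable _ _
    rw [chebCoeff_polynomial_succ, ih (derivative p) (by omega : j < n),
      ih (derivative p) (by omega : j < n + 2), ← intervalIntegral.integral_sub (hi _) (hi _),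
      ← intervalIntegral.integral_div]
    refine intervalIntegral.integral_congr fun t _ => ?_
    simp only [sinKernel, Nat.add_sub_cancel, Function.iterate_succ_apply]
    push_cast
    ring

/-! ### Tails of Chebyshev series -/

theorem norm_chebSeries_term_le (c : ℕ → ℝ) (j k : ℕ) {t : ℝ} (ht : t ∈ Icc (-1 : ℝ) 1) :
    ‖c k * (derivative^[j] (chebT k)).eval t‖ ≤ |c k| * ((k : ℝ) + 1) ^ (2 * j) := by
  rw [Real.norm_eq_abs, abs_mul]
  gcongr
  refine (abs_eval_iterate_derivative_chebT_le k j ht).trans ?_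
  gcongr
  linarith

/-- The kernel pairs with `T_k^(j+1)` to give the `n`-th coefficient of `T_k`, that is `1` or `0`
according to whether `k = n`. Summability permits termwise integration, so only polynomials are ever
integrated by parts. Since `n > 0`, the halved term plays no role. -/
theorem coeff_eq_integral_of_summable {c : ℕ → ℝ} {j : ℕ}
    (hc : Summable fun k => |c k| * ((k : ℝ) + 1) ^ (2 * (j + 1))) {n : ℕ} (hn : j < n) :
    c n = ∫ t in (-1 : ℝ)..1,
      (∑' k, c k * (derivative^[j + 1] (chebT k)).eval t) * sinKernel j n t := by
  set B : ℝ := 2 / π / ((n : ℝ) - j) ^ (j + 1) with hB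
  have hmem : ∀ {t : ℝ}, t ∈ uIoc (-1 : ℝ) 1 → t ∈ Icc (-1 : ℝ) 1 := fun {t} ht => by
    rw [uIoc_of_le (by norm_num)] at ht
    exact Ioc_subset_Icc_self ht
  have h := intervalIntegral.hasSum_integral_of_dominated_convergence (a := -1) (b := 1)
    (μ := volume)
    (F := fun k t => c k * (derivative^[j + 1] (chebT k)).eval t * sinKernel j n t)
    (f := fun t => (∑' k, c k * (derivative^[j + 1] (chebT k)).eval t) * sinKernel j n t)
    (fun k _ => |c k| * ((k : ℝ) + 1) ^ (2 * (j + 1)) * B)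
    (fun k => ((continuous_const.mul (Polynomial.continuous _)).mul
      (continuous_sinKernel _ _)).aestronglyMeasurable)
    (fun k => ae_of_all _ fun t ht => by
      rw [norm_mul]
      exact mul_le_mul (norm_chebSeries_term_le c _ k (hmem ht)) (abs_sinKernel_le hn t)
        (norm_nonneg _) (by positivity))
    (ae_of_all _ fun t _ => hc.mul_right B) intervalIntegrable_const
    (ae_of_all _ fun t ht => (Summable.of_norm_bounded hc fun k =>
      norm_chebSeries_term_le c _ k (hmem ht)).hasSum.mul_right _)
  refine HasSum.unique ?_ h
  have hterm : ∀ k, ∫ t in (-1 : ℝ)..1,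
      c k * (derivative^[j + 1] (chebT k)).eval t * sinKernel j n t =
        if k = n then c n else 0 := by
    intro k
    simp only [mul_assoc]
    rw [intervalIntegral.integral_const_mul, ← chebCoeff_polynomial_eq_integral _ hn,
      chebCoeff_chebT k (by omega)]
    split_ifs with hk
    · rw [hk, mul_one]
    · rw [mul_zero]
  simp only [hterm]
  exact hasSum_ite_eq n (c n)

/-- A discrete form of comparison with `∫ y^(-ℓ-1) dy`. Bernoulli's inequality for `(1 + 1/y)^ℓ`
bounds each term by a difference, and the differences telescope. -/
theorem sum_range_one_div_pow_le {ℓ : ℕ} (hℓ : 1 ≤ ℓ) {x : ℝ} (hx : 0 < x) (M : ℕ) :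
    ∑ i ∈ Finset.range M, 1 / (x + i + 1) ^ (ℓ + 1) ≤ 1 / (ℓ * x ^ ℓ) := by
  have hℓ0 : (0 : ℝ) < ℓ := Nat.cast_pos.2 hℓ
  have hstep : ∀ y : ℝ, 0 < y →
      1 / (y + 1) ^ (ℓ + 1) ≤ 1 / (ℓ * y ^ ℓ) - 1 / (ℓ * (y + 1) ^ ℓ) := by
    intro y hy
    have hb := one_add_mul_le_pow (a := 1 / y) (by have : 0 < 1 / y := by positivity
                                                   linarith) ℓ
    have h1 : (1 + 1 / y) ^ ℓ = (y + 1) ^ ℓ / y ^ ℓ := by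
      rw [← div_pow]; congr 1; field_simp
    have h2 : (ℓ : ℝ) / (y + 1) ≤ ℓ * (1 / y) := by
      rw [mul_one_div]
      gcongr
      linarith
    have h3 : 1 + (ℓ : ℝ) / (y + 1) ≤ (y + 1) ^ ℓ / y ^ ℓ := by linarith
    have h4 : 1 / (y + 1) ^ (ℓ + 1) = (1 + (ℓ : ℝ) / (y + 1)) * (1 / (ℓ * (y + 1) ^ ℓ)) -
        1 / (ℓ * (y + 1) ^ ℓ) := by
      rw [pow_succ]; field_simp; ring
    have h5 : 1 / (ℓ * y ^ ℓ) = (y + 1) ^ ℓ / y ^ ℓ * (1 / (ℓ * (y + 1) ^ ℓ)) := by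
      field_simp
    rw [h4, h5]
    gcongr
  have hsum : ∑ i ∈ Finset.range M, 1 / (x + i + 1) ^ (ℓ + 1) ≤
      ∑ i ∈ Finset.range M, (1 / (ℓ * (x + i) ^ ℓ) - 1 / (ℓ * (x + (i + 1 : ℕ)) ^ ℓ)) := by
    refine Finset.sum_le_sum fun i _ => ?_
    have := hstep (x + i) (by positivity)
    rwa [add_assoc x (i : ℝ) 1, ← Nat.cast_succ] at *
  refine hsum.trans ?_
  rw [Finset.sum_range_sub' (fun i : ℕ => 1 / (ℓ * (x + i) ^ ℓ))]
  have : 0 ≤ 1 / ((ℓ : ℝ) * (x + M) ^ ℓ) := by positivity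
  simp only [Nat.cast_zero, add_zero]
  linarith

theorem continuousOn_chebSeries {c : ℕ → ℝ} {j : ℕ}
    (hc : Summable fun k => |c k| * ((k : ℝ) + 1) ^ (2 * j)) :
    ContinuousOn (fun t => ∑' k, c k * (derivative^[j] (chebT k)).eval t) (Icc (-1) 1) :=
  continuousOn_tsum (fun _ => (continuous_const.mul (Polynomial.continuous _)).continuousOn) hc
    fun k _ ht => norm_chebSeries_term_le c j k ht

theorem abs_coeff_le_of_summable {c : ℕ → ℝ} {j : ℕ}
    (hc : Summable fun k => |c k| * ((k : ℝ) + 1) ^ (2 * (j + 1))) {n : ℕ} (hn : j < n) :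
    |c n| ≤ (∫ t in (-1 : ℝ)..1, |∑' k, c k * (derivative^[j + 1] (chebT k)).eval t|) *
      (2 / π / ((n : ℝ) - j) ^ (j + 1)) := by
  have hgc := (continuousOn_chebSeries hc).abs
  rw [coeff_eq_integral_of_summable hc hn, ← Real.norm_eq_abs,
    ← intervalIntegral.integral_mul_const]
  refine intervalIntegral.norm_integral_le_of_norm_le (by norm_num)
    (ae_of_all _ fun t _ => ?_) ?_
  · rw [norm_mul]
    exact mul_le_mul_of_nonneg_left (abs_sinKernel_le hn t) (norm_nonneg _)
  · refine ContinuousOn.intervalIntegrable ?_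
    rw [uIcc_neg_one_one]
    exact hgc.mul continuousOn_const

theorem summable_abs_of_summable_mul_pow {c : ℕ → ℝ} {s : ℕ}
    (hc : Summable fun k => |c k| * ((k : ℝ) + 1) ^ s) : Summable fun k => |c k| :=
  Summable.of_nonneg_of_le (fun _ => abs_nonneg _) (fun k => le_mul_of_one_le_right (abs_nonneg _)
    (one_le_pow₀ (by linarith [(Nat.cast_nonneg k : (0 : ℝ) ≤ k)]))) hc

/-- The tail of the coefficients of a Chebyshev series is controlled by the `L¹` norm of the
derivative of order `ℓ + 1` of its sum. -/
theorem abs_tsum_tail_le {c : ℕ → ℝ} {ℓ : ℕ} (hℓ : 1 ≤ ℓ)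
    (hc : Summable fun k => |c k| * ((k : ℝ) + 1) ^ (2 * (ℓ + 1))) {N : ℕ} (hN : ℓ < N) :
    |∑' i, c (i + (N + 1))| ≤
      (2 / (ℓ : ℝ) * ∫ t in (-1 : ℝ)..1, |∑' k, c k * (derivative^[ℓ + 1] (chebT k)).eval t|) *
        (1 / ((N : ℝ) - ℓ) ^ ℓ) := by
  have hb := fun n (hn : ℓ < n) => abs_coeff_le_of_summable hc hn
  obtain ⟨V, hV⟩ : ∃ V, V = ∫ t in (-1 : ℝ)..1,
    |∑' k, c k * (derivative^[ℓ + 1] (chebT k)).eval t| := ⟨_, rfl⟩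
  have hV0 : 0 ≤ V := hV ▸ intervalIntegral.integral_nonneg (by norm_num) fun _ _ => abs_nonneg _
  rw [← hV] at hb ⊢
  have hx : 0 < (N : ℝ) - ℓ := sub_pos.2 (Nat.cast_lt.2 hN)
  have hℓ0 : (0 : ℝ) < ℓ := Nat.cast_pos.2 hℓ
  have habs : Summable fun i => |c (i + (N + 1))| :=
    (summable_nat_add_iff (f := fun k => |c k|) (N + 1)).2 (summable_abs_of_summable_mul_pow hc)
  have hpart : ∀ M, ∑ i ∈ Finset.range M, |c (i + (N + 1))| ≤
      2 / ℓ * V * (1 / ((N : ℝ) - ℓ) ^ ℓ) := fun M => calc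
    ∑ i ∈ Finset.range M, |c (i + (N + 1))| ≤ ∑ i ∈ Finset.range M, V * (2 / π) * (1 / ((N : ℝ) - ℓ + i + 1) ^ (ℓ + 1)) := by
        refine Finset.sum_le_sum fun i _ => (hb _ (by omega)).trans_eq ?_
        have : ((i + (N + 1) : ℕ) : ℝ) - ℓ = (N : ℝ) - ℓ + i + 1 := by push_cast; ring
        rw [this]
        ring
    _ ≤ V * (2 / π) * (1 / (ℓ * ((N : ℝ) - ℓ) ^ ℓ)) := by
        rw [← Finset.mul_sum]
        exact mul_le_mul_of_nonneg_left (sum_range_one_div_pow_le hℓ hx M) (by positivity)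
    _ ≤ V * 2 * (1 / (ℓ * ((N : ℝ) - ℓ) ^ ℓ)) := by
        -- The argument yields the constant `2/(πℓ)`; the factor `1/π` is given away here.
        have h2 : 2 / π ≤ 2 := div_le_self (by norm_num) (by linarith [Real.pi_gt_three])
        have h3 : 0 ≤ 1 / (ℓ * ((N : ℝ) - ℓ) ^ ℓ) := by positivity
        exact mul_le_mul_of_nonneg_right (mul_le_mul_of_nonneg_left h2 hV0) h3
    _ = 2 / ℓ * V * (1 / ((N : ℝ) - ℓ) ^ ℓ) := by
        field_simp
  have hle := norm_tsum_le_tsum_norm (f := fun i => c (i + (N + 1))) habs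
  simp only [Real.norm_eq_abs] at hle
  refine hle.trans ?_
  exact Real.tsum_le_of_sum_range_le (fun _ => abs_nonneg _) hpart

/-! ### The Chebyshev expansion -/

theorem integral_mul_polynomial_eq_zero {d : ℝ → ℝ} (hd : ContinuousOn d (Icc (-1) 1))
    (h0 : ∀ n, chebCoeff d n = 0) (p : ℝ[X]) :
    ∫ t, d t * p.eval t ∂Polynomial.Chebyshev.measureT = 0 := by
  have hint : ∀ q : ℝ[X], Integrable (fun t => d t * q.eval t) Polynomial.Chebyshev.measureT :=
    fun q => Polynomial.Chebyshev.integrable_measureT (hd.mul q.continuous.continuousOn)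
  have hT : ∀ n : ℤ, ∫ t, d t * (Polynomial.Chebyshev.T ℝ n).eval t
      ∂Polynomial.Chebyshev.measureT = 0 := by
    intro n
    have h := h0 n.natAbs
    rw [chebCoeff_eq_integral_measureT, mul_eq_zero] at h
    have h1 := h.resolve_left (by positivity)
    rwa [chebT, Polynomial.Chebyshev.T_natAbs] at h1
  -- The extra factor `T_n` makes the induction on `p` close, since `2 X T_n = T_{n+1} + T_{n-1}`.
  -- Integer indices avoid a special case at `n = 0`.
  have hmul : ∀ n : ℤ, ∫ t, d t * (p * Polynomial.Chebyshev.T ℝ n).eval t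
      ∂Polynomial.Chebyshev.measureT = 0 := by
    induction p using Polynomial.induction_on with
    | C a =>
      intro n
      have e : ∀ t, d t * (C a * Polynomial.Chebyshev.T ℝ n).eval t =
          a * (d t * (Polynomial.Chebyshev.T ℝ n).eval t) := fun t => by
        rw [eval_mul, eval_C]; ring
      simp only [e, MeasureTheory.integral_const_mul, hT, mul_zero]
    | add p q hp hq =>
      intro n
      simp only [add_mul, eval_add, mul_add]
      rw [integral_add (hint _) (hint _), hp, hq, add_zero]
    | monomial k a ih =>
      intro n
      have e : ∀ t, d t * (C a * X ^ (k + 1) * Polynomial.Chebyshev.T ℝ n).eval t =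
          (d t * (C a * X ^ k * Polynomial.Chebyshev.T ℝ (n + 1)).eval t +
            d t * (C a * X ^ k * Polynomial.Chebyshev.T ℝ (n - 1)).eval t) / 2 := fun t => by
        rw [Polynomial.Chebyshev.T_add_one]
        simp only [eval_mul, eval_sub, eval_C, eval_pow, eval_X, eval_ofNat]
        ring
      simp only [e]
      rw [integral_div, integral_add (hint _) (hint _), ih, ih, add_zero, zero_div]
  simpa using hmul 0

/-- A continuous function on `[-1, 1]` is determined by its Chebyshev coefficients. -/
theorem eq_zero_of_chebCoeff_eq_zero {d : ℝ → ℝ} (hd : ContinuousOn d (Icc (-1) 1))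
    (h0 : ∀ n, chebCoeff d n = 0) {x : ℝ} (hx : x ∈ Icc (-1 : ℝ) 1) : d x = 0 := by
  have hsq : ∫ t, d t * d t ∂Polynomial.Chebyshev.measureT = 0 := by
    -- As `d` is orthogonal to all polynomials, `∫ d² = ∫ d (d - p)`, which Weierstrass
    -- approximation makes arbitrarily small.
    obtain ⟨M, hM⟩ : ∃ M, ∫ t, |d t| ∂Polynomial.Chebyshev.measureT = M := ⟨_, rfl⟩
    have hae : ∀ᵐ t ∂Polynomial.Chebyshev.measureT, t ∈ Icc (-1 : ℝ) 1 := by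
      rw [Polynomial.Chebyshev.measureT]
      exact (ae_restrict_mem measurableSet_Ioc).mono fun t ht => Ioc_subset_Icc_self ht
    have hM0 : 0 ≤ M := hM ▸ integral_nonneg fun _ => abs_nonneg _
    have hbound : ∀ ε > 0, |∫ t, d t * d t ∂Polynomial.Chebyshev.measureT| ≤ ε * M := by
      intro ε hε
      obtain ⟨p, hp⟩ := exists_polynomial_near_of_continuousOn (-1) 1 d hd ε hε
      have e : ∫ t, d t * d t ∂Polynomial.Chebyshev.measureT =
          ∫ t, (d t * d t - d t * p.eval t) ∂Polynomial.Chebyshev.measureT := by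
        have i1 : Integrable (fun t => d t * d t) Polynomial.Chebyshev.measureT :=
          Polynomial.Chebyshev.integrable_measureT (hd.mul hd)
        have i2 : Integrable (fun t => d t * p.eval t) Polynomial.Chebyshev.measureT :=
          Polynomial.Chebyshev.integrable_measureT (hd.mul p.continuous.continuousOn)
        rw [integral_sub i1 i2, integral_mul_polynomial_eq_zero hd h0, sub_zero]
      rw [e, ← hM, ← MeasureTheory.integral_const_mul, ← Real.norm_eq_abs]
      refine norm_integral_le_of_norm_le
        ((Polynomial.Chebyshev.integrable_measureT hd.abs).const_mul ε) (hae.mono fun t ht => ?_)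
      rw [← mul_sub, norm_mul, mul_comm, Real.norm_eq_abs, abs_sub_comm]
      exact mul_le_mul_of_nonneg_right (hp t ht).le (abs_nonneg _)
    have h1 : |∫ t, d t * d t ∂Polynomial.Chebyshev.measureT| ≤ 0 := by
      refine le_of_forall_pos_le_add fun ε hε => ?_
      refine (hbound (ε / (M + 1)) (by positivity)).trans ?_
      rw [zero_add, div_mul_eq_mul_div, div_le_iff₀ (by positivity)]
      nlinarith
    exact abs_nonpos_iff.1 h1
  by_contra hne
  -- In the angle variable the measure is Lebesgue measure on `[0, π]`, where a continuous
  -- nonnegative function that is positive somewhere has positive integral.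
  rw [Polynomial.Chebyshev.integral_measureT_eq_integral_cos] at hsq
  have hcont : ContinuousOn (fun θ => d (Real.cos θ) * d (Real.cos θ)) (Icc 0 π) := by
    have := hd.comp (Real.continuous_cos.continuousOn (s := Icc 0 π))
      (fun θ _ => ⟨Real.neg_one_le_cos θ, Real.cos_le_one θ⟩)
    exact this.mul this
  have := intervalIntegral.integral_pos Real.pi_pos hcont (fun θ _ => mul_self_nonneg _)
    ⟨Real.arccos x, ⟨Real.arccos_nonneg x, Real.arccos_le_pi x⟩, by
      rw [Real.cos_arccos hx.1 hx.2]
      exact mul_self_pos.2 hne⟩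
  exact this.ne' hsq

theorem summable_one_div_add_one_sq : Summable fun k : ℕ => 1 / ((k : ℝ) + 1) ^ 2 := by
  have := (summable_nat_add_iff 1).2 (Real.summable_one_div_nat_pow.2 (by norm_num : 1 < 2))
  simpa using this

theorem abs_dashWeight_le_one (n : ℕ) : |dashWeight n| ≤ 1 := by
  rw [dashWeight]
  split_ifs <;> norm_num

/-- The decay exponent `r + 2` leaves at least two spare powers. -/
theorem SmoothBV.summable_coeff {r : ℕ} {f : ℝ → ℝ} (hf : SmoothBV r f) {s : ℕ} (hs : s ≤ r) :
    Summable fun k => |dashWeight k * chebCoeff f k| * ((k : ℝ) + 1) ^ s := by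
  obtain ⟨K, hK⟩ := hf.exists_chebCoeff_bound
  refine Summable.of_nonneg_of_le (fun k => by positivity) (fun k => ?_)
    (summable_one_div_add_one_sq.mul_left K)
  have h1 : (1 : ℝ) ≤ (k : ℝ) + 1 := by linarith [(Nat.cast_nonneg k : (0 : ℝ) ≤ k)]
  rw [mul_one_div, le_div_iff₀ (by positivity), abs_mul]
  calc |dashWeight k| * |chebCoeff f k| * ((k : ℝ) + 1) ^ s * ((k : ℝ) + 1) ^ 2
      ≤ 1 * |chebCoeff f k| * ((k : ℝ) + 1) ^ r * ((k : ℝ) + 1) ^ 2 := by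
        gcongr
        exact abs_dashWeight_le_one k
    _ = |chebCoeff f k| * ((k : ℝ) + 1) ^ (r + 2) := by ring
    _ ≤ K := hK k

theorem chebCoeff_one_zero : chebCoeff (fun t => (chebT 0).eval t) 0 = 2 := by
  rw [chebCoeff_eq_integral_measureT]
  have := Polynomial.Chebyshev.integral_eval_T_real_mul_self_measureT_zero
  simp only [chebT, Nat.cast_zero]
  rw [this]
  field_simp

theorem chebCoeff_chebT_zero {k : ℕ} (hk : k ≠ 0) :
    chebCoeff (fun t => (chebT k).eval t) 0 = 0 := by
  rw [chebCoeff_eq_integral_measureT]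
  have := Polynomial.Chebyshev.integral_eval_T_real_mul_eval_T_real_measureT_of_ne hk
  simp only [chebT]
  rw [this, mul_zero]

/-- Halving the first term compensates for `α_0[T_0] = 2`, the only coefficient out of
normalization. -/
theorem dashWeight_mul_chebCoeff_chebT (k n : ℕ) :
    dashWeight k * chebCoeff (fun t => (chebT k).eval t) n = if k = n then 1 else 0 := by
  rcases Nat.eq_zero_or_pos n with rfl | hn
  · rcases Nat.eq_zero_or_pos k with rfl | hk
    · rw [chebCoeff_one_zero]; simp [dashWeight]
    · rw [chebCoeff_chebT_zero hk.ne', mul_zero, if_neg hk.ne']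
  · rw [chebCoeff_chebT k hn.ne']
    split_ifs with h
    · rw [h, dashWeight, if_neg hn.ne', one_mul]
    · rw [mul_zero]

/-- Orthogonality together with dominated convergence; the majorants are multiples of the integrable
weight `(1 - t²)^(-1/2)`. -/
theorem chebCoeff_chebSeries {a : ℕ → ℝ} (ha : Summable fun k => |dashWeight k * a k|) (n : ℕ) :
    chebCoeff (fun t => ∑' k, dashWeight k * a k * (chebT k).eval t) n = a n := by
  have hmem : ∀ {t : ℝ}, t ∈ uIoc (-1 : ℝ) 1 → t ∈ Icc (-1 : ℝ) 1 := fun {t} ht => by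
    rw [uIoc_of_le (by norm_num)] at ht
    exact Ioc_subset_Icc_self ht
  have hle : ∀ k {t : ℝ}, t ∈ Icc (-1 : ℝ) 1 →
      ‖dashWeight k * a k * (chebT k).eval t‖ ≤ |dashWeight k * a k| := fun k t ht => by
    rw [norm_mul]
    exact mul_le_of_le_one_right (abs_nonneg _) (abs_eval_chebT_le_one k ht)
  have h := intervalIntegral.hasSum_integral_of_dominated_convergence (a := -1) (b := 1)
    (μ := volume)
    (F := fun k t => dashWeight k * a k * (chebT k).eval t *
      ((chebT n).eval t * (√(1 - t ^ 2))⁻¹))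
    (f := fun t => (∑' k, dashWeight k * a k * (chebT k).eval t) *
      ((chebT n).eval t * (√(1 - t ^ 2))⁻¹))
    (fun k t => |dashWeight k * a k| * (√(1 - t ^ 2))⁻¹)
    (fun k => by
      have hc : Continuous fun t => dashWeight k * a k * (chebT k).eval t * (chebT n).eval t := by
        fun_prop
      have := (intervalIntegrable_inv_sqrt.continuousOn_mul
        hc.continuousOn).def'.aestronglyMeasurable
      simpa only [mul_assoc] using this)
    (fun k => ae_of_all _ fun t ht => by
      rw [norm_mul, norm_mul _ (√(1 - t ^ 2))⁻¹,
        Real.norm_of_nonneg (inv_nonneg.2 (Real.sqrt_nonneg (1 - t ^ 2)))]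
      refine mul_le_mul (hle k (hmem ht)) ?_ (mul_nonneg (norm_nonneg _)
        (inv_nonneg.2 (Real.sqrt_nonneg _))) (abs_nonneg _)
      exact mul_le_of_le_one_left (inv_nonneg.2 (Real.sqrt_nonneg _))
        (abs_eval_chebT_le_one n (hmem ht)))
    (ae_of_all _ fun t _ => ha.mul_right _)
    (by
      simp only [tsum_mul_right]
      exact intervalIntegrable_inv_sqrt.const_mul _)
    (ae_of_all _ fun t ht => (Summable.of_norm_bounded ha fun k =>
      hle k (hmem ht)).hasSum.mul_right _)
  have h2 := h.mul_left (2 / π)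
  have e : chebCoeff (fun t => ∑' k, dashWeight k * a k * (chebT k).eval t) n =
      2 / π * ∫ t in (-1 : ℝ)..1, (∑' k, dashWeight k * a k * (chebT k).eval t) *
      ((chebT n).eval t * (√(1 - t ^ 2))⁻¹) := by
    simp only [chebCoeff, div_eq_mul_inv, mul_assoc]
  rw [e]
  refine HasSum.unique h2 ?_
  have hterm : ∀ k, 2 / π * ∫ t in (-1 : ℝ)..1, dashWeight k * a k * (chebT k).eval t *
      ((chebT n).eval t * (√(1 - t ^ 2))⁻¹) = if k = n then a n else 0 := by
    intro k
    have h3 := dashWeight_mul_chebCoeff_chebT k n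
    have h4 : ∫ t in (-1 : ℝ)..1, dashWeight k * a k * (chebT k).eval t *
        ((chebT n).eval t * (√(1 - t ^ 2))⁻¹) = dashWeight k * a k *
          ∫ t in (-1 : ℝ)..1, (chebT k).eval t * (chebT n).eval t / √(1 - t ^ 2) := by
      rw [← intervalIntegral.integral_const_mul]
      refine intervalIntegral.integral_congr fun t _ => ?_
      simp only [div_eq_mul_inv, mul_assoc]
    have h5 : 2 / π * (dashWeight k * a k *
          ∫ t in (-1 : ℝ)..1, (chebT k).eval t * (chebT n).eval t / √(1 - t ^ 2)) =
        a k * (dashWeight k * chebCoeff (fun t => (chebT k).eval t) n) := by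
      rw [chebCoeff]; ring
    rw [h4, h5, h3]
    split_ifs with hk
    · rw [hk, mul_one]
    · rw [mul_zero]
  simp only [hterm]
  exact hasSum_ite_eq n (a n)

theorem chebCoeff_sub {f g : ℝ → ℝ} (hf : ContinuousOn f (Icc (-1) 1))
    (hg : ContinuousOn g (Icc (-1) 1)) (n : ℕ) :
    chebCoeff (fun t => f t - g t) n = chebCoeff f n - chebCoeff g n := by
  simp only [chebCoeff_eq_integral_measureT, sub_mul]
  rw [integral_sub, mul_sub]
  · exact Polynomial.Chebyshev.integrable_measureT (hf.mul (chebT n).continuous.continuousOn)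
  · exact Polynomial.Chebyshev.integrable_measureT (hg.mul (chebT n).continuous.continuousOn)

/-- The Chebyshev series of a smooth function can be differentiated term by term, up to the end
points of the interval. -/
theorem SmoothBV.derivI_eq_tsum {r : ℕ} {f : ℝ → ℝ} (hf : SmoothBV r f) {j : ℕ} (hj : 2 * j ≤ r)
    {x : ℝ} (hx : x ∈ Icc (-1 : ℝ) 1) :
    derivI j f x = ∑' k, dashWeight k * chebCoeff f k * (derivative^[j] (chebT k)).eval x := by
  induction j generalizing x with
  | zero =>
    have hs : Summable fun k => |dashWeight k * chebCoeff f k| * ((k : ℝ) + 1) ^ (2 * 0) :=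
      hf.summable_coeff (by omega)
    have hs' : Summable fun k => |dashWeight k * chebCoeff f k| := by simpa using hs
    have hF := continuousOn_chebSeries hs
    simp only [Function.iterate_zero, id_eq] at hF ⊢
    have hfc : ContinuousOn f (Icc (-1) 1) := hf.1.continuousOn
    have h := eq_zero_of_chebCoeff_eq_zero (hfc.fun_sub hF) (fun n => by
      rw [chebCoeff_sub hfc hF, chebCoeff_chebSeries hs', sub_self]) hx
    rw [show derivI 0 f = f from iteratedDerivWithin_zero]
    exact sub_eq_zero.1 h
  | succ j ih =>
    have hs : Summable fun k => |dashWeight k * chebCoeff f k| * ((k : ℝ) + 1) ^ (2 * (j + 1)) :=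
      hf.summable_coeff (by omega)
    have hs0 : Summable fun k => |dashWeight k * chebCoeff f k| * ((k : ℝ) + 1) ^ (2 * j) :=
      hf.summable_coeff (by omega)
    -- Inside the interval the series of derivatives converges uniformly, so ordinary termwise
    -- differentiation applies.
    have hopen : ∀ y ∈ Ioo (-1 : ℝ) 1, derivI (j + 1) f y =
        ∑' k, dashWeight k * chebCoeff f k * (derivative^[j + 1] (chebT k)).eval y := by
      intro y hy
      have h1 := hasDerivAt_tsum_of_isPreconnected
        (g := fun k t => dashWeight k * chebCoeff f k * (derivative^[j] (chebT k)).eval t)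
        (g' := fun k t => dashWeight k * chebCoeff f k * (derivative^[j + 1] (chebT k)).eval t)
        hs isOpen_Ioo isPreconnected_Ioo (fun k t _ => by
          rw [Function.iterate_succ_apply']
          exact (Polynomial.hasDerivAt _ t).const_mul _)
        (fun k t ht => norm_chebSeries_term_le (fun k => dashWeight k * chebCoeff f k) _ k (Ioo_subset_Icc_self ht)) hy
        (Summable.of_norm_bounded hs0 fun k =>
          norm_chebSeries_term_le (fun k => dashWeight k * chebCoeff f k) _ k (Ioo_subset_Icc_self hy)) hy
      have h2 := hasDerivAt_derivI hf.1 (by omega : j < r) hy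
      refine h2.unique (h1.congr_of_eventuallyEq ?_)
      filter_upwards [Ioo_mem_nhds hy.1 hy.2] with z hz
        using ih (by omega) (Ioo_subset_Icc_self hz)
    -- Both sides are continuous on the closed interval, which carries the identity over to the
    -- one-sided derivatives at `±1`.
    have hcl : closure (Ioo (-1 : ℝ) 1) = Icc (-1) 1 := closure_Ioo (by norm_num)
    have heq := Set.EqOn.of_subset_closure (s := Ioo (-1 : ℝ) 1) (t := Icc (-1 : ℝ) 1) hopen
      (continuousOn_derivI hf.1 (by omega)) (continuousOn_chebSeries hs) Ioo_subset_Icc_self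
      hcl.ge
    exact heq hx

theorem SmoothBV.hasSum_derivI {r : ℕ} {f : ℝ → ℝ} (hf : SmoothBV r f) {j : ℕ} (hj : 2 * j ≤ r)
    {x : ℝ} (hx : x ∈ Icc (-1 : ℝ) 1) :
    HasSum (fun k => dashWeight k * chebCoeff f k * (derivative^[j] (chebT k)).eval x)
      (derivI j f x) := by
  rw [hf.derivI_eq_tsum hj hx]
  exact (Summable.of_norm_bounded (hf.summable_coeff hj) fun k =>
    norm_chebSeries_term_le (fun k => dashWeight k * chebCoeff f k) _ k hx).hasSum

/-! ### Polynomials of a matrix and its Jordan form -/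

/-- The Taylor coefficient matrix of a polynomial at `c`, which is `p` of a Jordan block. -/
noncomputable def polyJordanBlock (p : ℝ[X]) (n : ℕ) (c : ℝ) : Matrix (Fin n) (Fin n) ℝ :=
  Matrix.of fun i j => if i ≤ j then
    (derivative^[j.val - i.val] p).eval c / (Nat.factorial (j.val - i.val) : ℝ) else 0

theorem polyJordanBlock_C (a : ℝ) (n : ℕ) (c : ℝ) :
    polyJordanBlock (C a) n c = a • (1 : Matrix (Fin n) (Fin n) ℝ) := by
  ext i j
  simp only [polyJordanBlock, Matrix.of_apply, Matrix.smul_apply, Matrix.one_apply, smul_eq_mul]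
  by_cases hij : i = j
  · subst hij; simp
  · rw [if_neg hij, mul_zero]
    split_ifs with h
    · have : 0 < j.val - i.val := by
        have := lt_of_le_of_ne h hij
        omega
      rw [iterate_derivative_C this]
      simp
    · rfl

theorem polyJordanBlock_add (p q : ℝ[X]) (n : ℕ) (c : ℝ) :
    polyJordanBlock (p + q) n c = polyJordanBlock p n c + polyJordanBlock q n c := by
  ext i j
  simp only [polyJordanBlock, Matrix.of_apply, Matrix.add_apply, iterate_map_add, eval_add]
  split_ifs
  · ring
  · rw [add_zero]

/-- Entrywise this is the Leibniz rule `(X p)^(d+1) = X p^(d+1) + (d+1) p^(d)` divided by `(d+1)!`.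
The second term comes from the superdiagonal of the Jordan block. -/
theorem polyJordanBlock_X_mul (p : ℝ[X]) (n : ℕ) (c : ℝ) :
    polyJordanBlock (X * p) n c = jordanBlock n c * polyJordanBlock p n c := by
  ext i j
  rw [Matrix.mul_apply]
  have h1 : ∀ l : Fin n, jordanBlock n c i l * polyJordanBlock p n c l j =
      (if i = l then c * polyJordanBlock p n c i j else 0) +
        if i.val + 1 = l.val then polyJordanBlock p n c l j else 0 := by
    intro l
    simp only [jordanBlock, Matrix.of_apply]
    by_cases h : i = l
    · subst h; simp
    · simp [h]
  simp only [h1, Finset.sum_add_distrib, Finset.sum_ite_eq, Finset.mem_univ, if_true]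
  by_cases hij : i ≤ j
  · rcases hij.eq_or_lt with rfl | hlt
    · rw [Finset.sum_eq_zero]
      · simp [polyJordanBlock]
      · intro l _
        split_ifs with h
        · have : ¬ l ≤ i := by rw [Fin.le_def]; omega
          simp [polyJordanBlock, this]
        · rfl
    · have hlt' : i.val < j.val := hlt
      obtain ⟨d, hd⟩ : ∃ d, j.val - i.val = d + 1 := ⟨j.val - i.val - 1, by omega⟩
      have hin : i.val + 1 < n := by omega
      rw [Finset.sum_eq_single (⟨i.val + 1, hin⟩ : Fin n)]
      · have hle : (⟨i.val + 1, hin⟩ : Fin n) ≤ j := by rw [Fin.le_def]; simp only; omega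
        have hd' : j.val - (i.val + 1) = d := by omega
        simp only [polyJordanBlock, Matrix.of_apply, if_pos hij, if_pos hle, hd, hd', if_true]
        have hder : derivative^[d + 1] (X * p) =
            X * derivative^[d + 1] p + (d + 1 : ℝ[X]) * derivative^[d] p := by
          have := iterate_derivative_mul_X (n := d + 1) p
          rw [mul_comm p X, mul_comm _ X] at this
          simpa using this
        rw [hder]
        simp only [eval_add, eval_mul, eval_X, eval_natCast, eval_one, Nat.factorial_succ]
        push_cast
        field_simp
      · intro l _ hl
        rw [if_neg]
        intro h
        exact hl (Fin.ext h.symm)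
      · simp
  · rw [Finset.sum_eq_zero]
    · simp [polyJordanBlock, hij]
    · intro l _
      split_ifs with h
      · have : ¬ l ≤ j := by rw [Fin.le_def] at hij ⊢; omega
        simp [polyJordanBlock, this]
      · rfl

variable {k : ℕ} {A : Matrix (Fin k) (Fin k) ℝ}

theorem JordanForm.mul_Zinv_eq (D : JordanForm A) : A * D.Zinv =
    D.Zinv * Matrix.blockDiagonal' fun i => jordanBlock (D.size i) (D.eig i) := by
  have h := congrArg (· * D.Zinv) D.eq_conj
  simpa only [Matrix.mul_assoc, D.mul_Zinv, Matrix.mul_one] using h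

/-- A polynomial of a matrix, computed from the Jordan form. -/
theorem JordanForm.aeval_eq (D : JordanForm A) (p : ℝ[X]) :
    aeval A p = D.Zinv * Matrix.blockDiagonal' (fun i => polyJordanBlock p (D.size i) (D.eig i)) *
      D.Z := by
  have hX : ∀ p : ℝ[X], aeval A p = D.Zinv * Matrix.blockDiagonal'
      (fun i => polyJordanBlock p (D.size i) (D.eig i)) * D.Z →
      aeval A (X * p) = D.Zinv * Matrix.blockDiagonal'
        (fun i => polyJordanBlock (X * p) (D.size i) (D.eig i)) * D.Z := by
    intro p hp
    simp only [polyJordanBlock_X_mul, Matrix.blockDiagonal'_mul]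
    rw [map_mul, aeval_X, hp, ← Matrix.mul_assoc, ← Matrix.mul_assoc, D.mul_Zinv_eq,
      Matrix.mul_assoc D.Zinv]
  have hC : ∀ a : ℝ, aeval A (C a) = D.Zinv * Matrix.blockDiagonal'
        (fun i => polyJordanBlock (C a) (D.size i) (D.eig i)) * D.Z := by
    intro a
    have h1 : (fun i => polyJordanBlock (C a) (D.size i) (D.eig i)) =
        a • fun i => (1 : Matrix (Fin (D.size i)) (Fin (D.size i)) ℝ) := by
      funext i; exact polyJordanBlock_C _ _ _
    have h2 : Matrix.blockDiagonal' (fun i => (1 : Matrix (Fin (D.size i)) (Fin (D.size i)) ℝ)) = 1 :=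
      Matrix.blockDiagonal'_one
    rw [h1, Matrix.blockDiagonal'_smul, h2, Matrix.mul_smul, Matrix.mul_one, Matrix.smul_mul,
      D.Zinv_mul, aeval_C, Algebra.algebraMap_eq_smul_one]
  induction p using Polynomial.induction_on with
  | C a => exact hC a
  | add p q hp hq =>
    have h1 : (fun i => polyJordanBlock (p + q) (D.size i) (D.eig i)) =
        (fun i => polyJordanBlock p (D.size i) (D.eig i)) +
          fun i => polyJordanBlock q (D.size i) (D.eig i) := by
      funext i; exact polyJordanBlock_add _ _ _ _
    rw [h1, Matrix.blockDiagonal'_add, Matrix.mul_add, Matrix.add_mul, map_add, hp, hq]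
  | monomial n a ih =>
    have := hX _ ih
    rwa [show X * (C a * X ^ n) = C a * X ^ (n + 1) by ring] at this

/-- The first basis vector of a block, which exists by `size_pos`, is an eigenvector of `J`, and
`Zinv` carries it to one of `A`. This transfers the spectral bound on `A` to the eigenvalues listed
in the Jordan form. -/
theorem JordanForm.eig_mem_spectrum (D : JordanForm A) (i : Fin D.numBlocks) :
    D.eig i ∈ spectrum ℝ A := by
  classical
  rw [spectrum.mem_iff]
  intro hu
  set B := Matrix.blockDiagonal' (fun i => jordanBlock (D.size i) (D.eig i)) with hB
  set x : Σ i, Fin (D.size i) := ⟨i, ⟨0, D.size_pos i⟩⟩ with hx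
  obtain ⟨M, hM⟩ := hu.exists_left_inv
  set e : (Σ i, Fin (D.size i)) → ℝ := Pi.single x 1 with he
  have hBe : B.mulVec e = D.eig i • e := by
    ext ⟨y, j⟩
    rw [he, Matrix.mulVec_single_one, Matrix.col_apply, Pi.smul_apply, smul_eq_mul]
    by_cases hy : y = i
    · subst hy
      rw [hB, hx, Matrix.blockDiagonal'_apply_eq]
      by_cases hj : j = ⟨0, D.size_pos y⟩
      · subst hj
        simp [jordanBlock]
      · rw [Pi.single_eq_of_ne (by simpa using hj)]
        simp [jordanBlock, hj]
    · rw [hB, hx, Matrix.blockDiagonal'_apply_ne _ _ _ hy, Pi.single_eq_of_ne (by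
        intro h; exact hy (congrArg Sigma.fst h)), mul_zero]
  have hAe : (algebraMap ℝ (Matrix (Fin k) (Fin k) ℝ) (D.eig i) - A).mulVec (D.Zinv.mulVec e) = 0 := by
    rw [Matrix.sub_mulVec, Algebra.algebraMap_eq_smul_one, Matrix.smul_mulVec, Matrix.one_mulVec]
    rw [Matrix.mulVec_mulVec, D.mul_Zinv_eq, ← Matrix.mulVec_mulVec, hBe, Matrix.mulVec_smul,
      sub_self]
  have h0 : D.Zinv.mulVec e = 0 := by
    have := congrArg M.mulVec hAe
    rwa [Matrix.mulVec_mulVec, hM, Matrix.one_mulVec, Matrix.mulVec_zero] at this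
  have h1 : e = 0 := by
    have := congrArg D.Z.mulVec h0
    rwa [Matrix.mulVec_mulVec, D.mul_Zinv, Matrix.one_mulVec, Matrix.mulVec_zero] at this
  have h2 := congrFun h1 x
  simp [he] at h2

theorem JordanForm.eig_mem_Icc (D : JordanForm A) (hρ : ∀ μ ∈ spectrum ℝ A, |μ| ≤ 1)
    (i : Fin D.numBlocks) : D.eig i ∈ Icc (-1 : ℝ) 1 :=
  abs_le.1 (hρ _ (D.eig_mem_spectrum i))

theorem JordanForm.size_le (D : JordanForm A) (i : Fin D.numBlocks) :
    D.size i ≤ D.maxBlockSize :=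
  Finset.le_sup (f := D.size) (Finset.mem_univ i)

theorem JordanForm.conj_apply (D : JordanForm A)
    (B : Matrix (Σ i, Fin (D.size i)) (Σ i, Fin (D.size i)) ℝ) (i j : Fin k) :
    (D.Zinv * B * D.Z) i j = ∑ y, ∑ x, D.Zinv i x * B x y * D.Z y j := by
  simp only [Matrix.mul_apply, Finset.sum_mul]

/-- The entries of `T_n(A)` grow like `n^(2m-2)`, where `m` is the largest size of a block. -/
theorem JordanForm.exists_abs_aeval_chebT_le (D : JordanForm A)
    (hρ : ∀ μ ∈ spectrum ℝ A, |μ| ≤ 1) :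
    ∃ K, 0 ≤ K ∧ ∀ n i j, |(aeval A (chebT n)) i j| * ((n : ℝ) + 1) ^ 2 ≤
      K * ((n : ℝ) + 1) ^ (2 * D.maxBlockSize) := by
  classical
  refine ⟨∑ i, ∑ j, ∑ y, ∑ x, |D.Zinv i x| * |D.Z y j|, by positivity, fun n i j => ?_⟩
  -- The power `2m - 2`, written as a quotient to avoid truncated subtraction when there are no
  -- blocks.
  set b : ℝ := ((n : ℝ) + 1) ^ (2 * D.maxBlockSize) / ((n : ℝ) + 1) ^ 2 with hb
  have hb0 : 0 ≤ b := by positivity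
  have hentry : ∀ x y, |Matrix.blockDiagonal'
      (fun i => polyJordanBlock (chebT n) (D.size i) (D.eig i)) x y| ≤ b := by
    rintro ⟨x, p⟩ ⟨y, q⟩
    by_cases hxy : x = y
    · subst hxy
      rw [Matrix.blockDiagonal'_apply_eq, polyJordanBlock, Matrix.of_apply]
      split_ifs with hpq
      · rw [abs_div, Nat.abs_cast]
        refine (div_le_self (abs_nonneg _) (by exact_mod_cast Nat.factorial_pos _)).trans ?_
        refine (abs_eval_iterate_derivative_chebT_le n _ (D.eig_mem_Icc hρ x)).trans ?_
        rw [hb, le_div_iff₀ (by positivity)]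
        -- At most `m - 1` derivatives occur in a block, which is where two powers are saved over
        -- the crude count `n^(2m)`.
        have hlt : q.val - p.val + 1 ≤ D.maxBlockSize := by
          have h1 := q.2
          have h2 := D.size_le x
          omega
        calc (n : ℝ) ^ (2 * (q.val - p.val)) * ((n : ℝ) + 1) ^ 2
            ≤ ((n : ℝ) + 1) ^ (2 * (q.val - p.val)) * ((n : ℝ) + 1) ^ 2 := by
              gcongr
              linarith
          _ = ((n : ℝ) + 1) ^ (2 * (q.val - p.val + 1)) := by ring
          _ ≤ ((n : ℝ) + 1) ^ (2 * D.maxBlockSize) := by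
              refine pow_le_pow_right₀ ?_ (by omega)
              linarith [(Nat.cast_nonneg n : (0 : ℝ) ≤ n)]
      · rwa [abs_zero]
    · rw [Matrix.blockDiagonal'_apply_ne _ _ _ hxy, abs_zero]
      exact hb0
  have h1 : |(aeval A (chebT n)) i j| ≤ (∑ y, ∑ x, |D.Zinv i x| * |D.Z y j|) * b := by
    rw [D.aeval_eq, D.conj_apply, Finset.sum_mul]
    refine (Finset.abs_sum_le_sum_abs _ _).trans (Finset.sum_le_sum fun y _ => ?_)
    rw [Finset.sum_mul]
    refine (Finset.abs_sum_le_sum_abs _ _).trans (Finset.sum_le_sum fun x _ => ?_)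
    rw [abs_mul, abs_mul, mul_right_comm]
    exact mul_le_mul_of_nonneg_left (hentry x y) (by positivity)
  have h2 : ∑ y, ∑ x, |D.Zinv i x| * |D.Z y j| ≤
      ∑ i, ∑ j, ∑ y, ∑ x, |D.Zinv i x| * |D.Z y j| :=
    (Finset.single_le_sum (f := fun j => ∑ y, ∑ x, |D.Zinv i x| * |D.Z y j|)
      (fun _ _ => by positivity) (Finset.mem_univ j)).trans
      (Finset.single_le_sum (f := fun i => ∑ j, ∑ y, ∑ x, |D.Zinv i x| * |D.Z y j|)
        (fun _ _ => by positivity) (Finset.mem_univ i))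
  have h3 := h1.trans (mul_le_mul_of_nonneg_right h2 hb0)
  rwa [hb, ← mul_div_assoc, le_div_iff₀ (by positivity)] at h3

/-- The Chebyshev expansion of the matrix function. -/
theorem JordanForm.hasSum_matFun (D : JordanForm A) (hρ : ∀ μ ∈ spectrum ℝ A, |μ| ≤ 1)
    {r : ℕ} {f : ℝ → ℝ} (hf : SmoothBV r f) (hr : 2 * D.maxBlockSize ≤ r) :
    HasSum (fun n => (dashWeight n * chebCoeff f n) • aeval A (chebT n)) (D.matFun f) := by
  classical
  have hentry : ∀ x y, HasSum (fun n => dashWeight n * chebCoeff f n * Matrix.blockDiagonal'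
      (fun i => polyJordanBlock (chebT n) (D.size i) (D.eig i)) x y)
      (Matrix.blockDiagonal' (fun i => funJordanBlock f (D.size i) (D.eig i)) x y) := by
    rintro ⟨x, p⟩ ⟨y, q⟩
    by_cases hxy : x = y
    · subst hxy
      simp only [Matrix.blockDiagonal'_apply_eq, polyJordanBlock, funJordanBlock, Matrix.of_apply]
      split_ifs with hpq
      · have hlt : 2 * (q.val - p.val) ≤ r := by
          have h1 := q.2
          have h2 := D.size_le x
          omega
        have := (hf.hasSum_derivI hlt (D.eig_mem_Icc hρ x)).div_const
          (Nat.factorial (q.val - p.val) : ℝ)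
        simpa only [mul_div_assoc] using this
      · simp
    · simp only [Matrix.blockDiagonal'_apply_ne _ _ _ hxy, mul_zero]
      exact hasSum_zero
  refine Pi.hasSum.2 fun i => Pi.hasSum.2 fun j => ?_
  rw [JordanForm.matFun, D.conj_apply]
  have h := hasSum_sum (s := Finset.univ) fun y _ => hasSum_sum (s := Finset.univ) fun x _ =>
    ((hentry x y).mul_left (D.Zinv i x)).mul_right (D.Z y j)
  refine h.congr_fun fun n => ?_
  rw [Matrix.smul_apply, D.aeval_eq, D.conj_apply, smul_eq_mul, Finset.mul_sum]
  refine Finset.sum_congr rfl fun y _ => ?_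
  rw [Finset.mul_sum]
  refine Finset.sum_congr rfl fun x _ => ?_
  ring

/-! ### Seminorms on matrices and the main theorem -/

/-- Expanding in matrix units dominates `ν` by a weighted sum of absolute values of entries, and the
reverse triangle inequality does the rest. -/
theorem continuous_seminorm_matrix {k : ℕ} (ν : Seminorm ℝ (Matrix (Fin k) (Fin k) ℝ)) :
    Continuous ν := by
  classical
  have hle : ∀ X, ν X ≤ ∑ i, ∑ j, |X i j| * ν (Matrix.single i j 1) := by
    intro X
    conv_lhs => rw [Matrix.matrix_eq_sum_single X]
    refine (Finset.le_sum_of_subadditive ν (map_zero ν).le (map_add_le_add ν) _ _).trans (Finset.sum_le_sum fun i _ => ?_)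
    refine (Finset.le_sum_of_subadditive ν (map_zero ν).le (map_add_le_add ν) _ _).trans (Finset.sum_le_sum fun j _ => ?_)
    have : Matrix.single i j (X i j) = X i j • Matrix.single i j (1 : ℝ) := by
      rw [Matrix.smul_single, smul_eq_mul, mul_one]
    rw [this, map_smul_eq_mul, Real.norm_eq_abs]
  refine continuous_iff_continuousAt.2 fun X => ?_
  have hc : Continuous fun Y : Matrix (Fin k) (Fin k) ℝ =>
      ∑ i, ∑ j, |(Y - X) i j| * ν (Matrix.single i j 1) := by
    refine continuous_finsetSum _ fun i _ => continuous_finsetSum _ fun j _ => ?_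
    exact (((continuous_id.sub continuous_const).matrix_elem i j).abs).mul continuous_const
  have h0 := hc.tendsto X
  simp only [sub_self, Matrix.zero_apply, abs_zero, zero_mul, Finset.sum_const_zero] at h0
  rw [ContinuousAt, tendsto_iff_dist_tendsto_zero]
  refine squeeze_zero (fun _ => dist_nonneg) (fun Y => ?_) h0
  rw [Real.dist_eq]
  exact (abs_sub_map_le_sub ν Y X).trans (hle _)

/-- The Hahn-Banach theorem for a seminorm at a vector. -/
theorem exists_linearMap_eq_seminorm {E : Type*} [AddCommGroup E] [Module ℝ E]
    (ν : Seminorm ℝ E) (x : E) : ∃ φ : E →ₗ[ℝ] ℝ, φ x = ν x ∧ ∀ y, |φ y| ≤ ν y := by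
  by_cases hx : x = 0
  · exact ⟨0, by simp [hx], fun y => by simp⟩
  obtain ⟨φ, hφ, hle⟩ := exists_extension_of_le_sublinear
    (LinearPMap.mkSpanSingleton (K := ℝ) x (ν x) hx) ν
    (fun c hc y => by rw [map_smul_eq_mul, Real.norm_of_nonneg hc.le]) (map_add_le_add ν) (by
      rintro ⟨y, hy⟩
      obtain ⟨c, rfl⟩ := Submodule.mem_span_singleton.1 hy
      refine (LinearPMap.mkSpanSingleton'_apply (σ := RingHom.id ℝ) x (ν x) _ c hy).trans_le ?_
      rw [map_smul_eq_mul, smul_eq_mul]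
      exact mul_le_mul_of_nonneg_right (Real.le_norm_self c) (apply_nonneg _ _))
  refine ⟨φ, ?_, fun y => abs_le.2 ⟨?_, hle y⟩⟩
  · have h := hφ ⟨x, Submodule.mem_span_singleton_self x⟩
    exact h.trans (LinearPMap.mkSpanSingleton_apply ℝ ℝ (σ := RingHom.id ℝ) hx (ν x))
  · have := hle (-y)
    rw [map_neg, map_neg_eq_map] at this
    linarith

theorem chebDerivTerm_apply {k : ℕ} (f : ℝ → ℝ) (A : Matrix (Fin k) (Fin k) ℝ) (s : ℕ) (t : ℝ)
    (n : ℕ) (i j : Fin k) : chebDerivTerm f A s t n i j =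
      dashWeight n * chebCoeff f n * (aeval A (chebT n)) i j *
        (derivative^[s] (chebT n)).eval t := by
  rw [chebDerivTerm, Matrix.smul_apply, smul_eq_mul]
  ring

/-- The scalar coefficients stay summable against `(n+1)^(2m+s)`, and the entries of `T_n(A)` use up
only `2m - 2` of these powers. -/
theorem JordanForm.summable_coeff {k : ℕ} {A : Matrix (Fin k) (Fin k) ℝ} (D : JordanForm A)
    (hρ : ∀ μ ∈ spectrum ℝ A, |μ| ≤ 1) {s : ℕ} {f : ℝ → ℝ}
    (hf : SmoothBV (2 * D.maxBlockSize + s) f) (i j : Fin k) :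
    Summable fun n => |dashWeight n * chebCoeff f n * (aeval A (chebT n)) i j| *
      ((n : ℝ) + 1) ^ (s + 2) := by
  obtain ⟨K, hK0, hK⟩ := D.exists_abs_aeval_chebT_le hρ
  refine Summable.of_nonneg_of_le (fun _ => by positivity) (fun n => ?_)
    ((hf.summable_coeff le_rfl).mul_left K)
  rw [abs_mul]
  calc |dashWeight n * chebCoeff f n| * |(aeval A (chebT n)) i j| * ((n : ℝ) + 1) ^ (s + 2)
      = |dashWeight n * chebCoeff f n| *
          (|(aeval A (chebT n)) i j| * ((n : ℝ) + 1) ^ 2) * ((n : ℝ) + 1) ^ s := by ring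
    _ ≤ |dashWeight n * chebCoeff f n| * (K * ((n : ℝ) + 1) ^ (2 * D.maxBlockSize)) *
          ((n : ℝ) + 1) ^ s := by
        exact mul_le_mul_of_nonneg_right (mul_le_mul_of_nonneg_left (hK n i j) (abs_nonneg _))
          (by positivity)
    _ = K * (|dashWeight n * chebCoeff f n| * ((n : ℝ) + 1) ^ (2 * D.maxBlockSize + s)) := by ring

theorem summable_chebDerivTerm {k : ℕ} {A : Matrix (Fin k) (Fin k) ℝ} {f : ℝ → ℝ} {s : ℕ}
    (hs : ∀ i j, Summable fun n => |dashWeight n * chebCoeff f n * (aeval A (chebT n)) i j| *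
      ((n : ℝ) + 1) ^ (2 * s)) {t : ℝ} (ht : t ∈ Icc (-1 : ℝ) 1) :
    Summable (chebDerivTerm f A s t) := by
  refine Pi.summable.2 fun i => Pi.summable.2 fun j => ?_
  simp only [chebDerivTerm_apply]
  exact Summable.of_norm_bounded (hs i j) fun n => norm_chebSeries_term_le
    (fun n => dashWeight n * chebCoeff f n * (aeval A (chebT n)) i j) s n ht

theorem continuousOn_tsum_chebDerivTerm {k : ℕ} {A : Matrix (Fin k) (Fin k) ℝ} {f : ℝ → ℝ} {s : ℕ}
    (hs : ∀ i j, Summable fun n => |dashWeight n * chebCoeff f n * (aeval A (chebT n)) i j| *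
      ((n : ℝ) + 1) ^ (2 * s)) :
    ContinuousOn (fun t => ∑' n, chebDerivTerm f A s t n) (Icc (-1) 1) := by
  refine continuousOn_pi.2 fun i => continuousOn_pi.2 fun j => ?_
  refine (continuousOn_chebSeries (hs i j)).congr fun t ht => ?_
  have h1 := summable_chebDerivTerm hs ht
  have h2 := Pi.summable.1 h1 i
  have e : (∑' n, chebDerivTerm f A s t n) i j = ∑' n, chebDerivTerm f A s t n i j :=
    (congrFun (tsum_apply h1) j).trans (tsum_apply h2)
  simp only [e, chebDerivTerm_apply]

end ChebMatrix

theorem mainTheorem6 (m ℓ : ℕ) (hℓ : 1 ≤ ℓ) (f : ℝ → ℝ)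
    (hf : ChebMatrix.SmoothBV (2 * m + 2 * ℓ) f)
    (k : ℕ) (A : Matrix (Fin k) (Fin k) ℝ)
    (hA : A.charpoly.Splits) (hρ : ∀ μ ∈ spectrum ℝ A, |μ| ≤ 1)
    (D : ChebMatrix.JordanForm A) (hm : D.maxBlockSize = m)
    (ν : Seminorm ℝ (Matrix (Fin k) (Fin k) ℝ)) (hν : ∀ X, ν X = 0 → X = 0) :
    (∀ t ∈ Set.Icc (-1 : ℝ) 1, Summable (ChebMatrix.chebDerivTerm f A (ℓ + 1) t)) ∧
    IntervalIntegrable (fun t => ν (∑' n, ChebMatrix.chebDerivTerm f A (ℓ + 1) t n))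
      MeasureTheory.volume (-1) 1 ∧
    ∀ N : ℕ, ℓ < N →
      ν (ChebMatrix.chebPartialSum f N A - D.matFun f) ≤
        (2 / (ℓ : ℝ) * ∫ t in (-1 : ℝ)..1, ν (∑' n, ChebMatrix.chebDerivTerm f A (ℓ + 1) t n)) *
          (1 / ((N : ℝ) - ℓ) ^ ℓ) := by
  subst hm
  have hs := D.summable_coeff hρ hf
  -- With `s = 2ℓ`, the available exponent `2ℓ + 2` is exactly what the derivative of order `ℓ + 1`
  -- of `T_n` requires.
  have hs' : ∀ i j, Summable fun n => |ChebMatrix.dashWeight n * ChebMatrix.chebCoeff f n *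
      (aeval A (ChebMatrix.chebT n)) i j| * ((n : ℝ) + 1) ^ (2 * (ℓ + 1)) := hs
  have hsum := fun t (ht : t ∈ Icc (-1 : ℝ) 1) => ChebMatrix.summable_chebDerivTerm hs' ht
  have hint : IntervalIntegrable (fun t => ν (∑' n, ChebMatrix.chebDerivTerm f A (ℓ + 1) t n))
      volume (-1) 1 := by
    refine ContinuousOn.intervalIntegrable ?_
    rw [ChebMatrix.uIcc_neg_one_one]
    exact (ChebMatrix.continuous_seminorm_matrix ν).comp_continuousOn
      (ChebMatrix.continuousOn_tsum_chebDerivTerm hs')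
  refine ⟨hsum, hint, fun N hN => ?_⟩
  -- The functional depends on `N`, but it enters the final bound only through `|φ| ≤ ν`.
  obtain ⟨φ, hφ, hle⟩ := ChebMatrix.exists_linearMap_eq_seminorm ν
    (ChebMatrix.chebPartialSum f N A - D.matFun f)
  have hφc : Continuous φ := φ.continuous_of_finiteDimensional
  set c : ℕ → ℝ := fun n => φ ((ChebMatrix.dashWeight n * ChebMatrix.chebCoeff f n) •
    aeval A (ChebMatrix.chebT n)) with hc
  have hcs : Summable fun n => |c n| * ((n : ℝ) + 1) ^ (2 * (ℓ + 1)) := by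
    -- The growing weight is put inside the matrix series, so that continuity of `φ` gives the
    -- weighted scalar series at once.
    have h1 : Summable fun n : ℕ => (((n : ℝ) + 1) ^ (2 * (ℓ + 1)) * (ChebMatrix.dashWeight n *
        ChebMatrix.chebCoeff f n)) • aeval A (ChebMatrix.chebT n) := by
      refine Pi.summable.2 fun i => Pi.summable.2 fun j => ?_
      refine Summable.of_norm_bounded (hs' i j) fun n => le_of_eq ?_
      rw [Matrix.smul_apply, smul_eq_mul, mul_assoc, norm_mul, Real.norm_of_nonneg (by positivity),
        mul_comm, Real.norm_eq_abs]
    have h2 := (h1.map φ hφc).abs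
    refine h2.congr fun n => ?_
    simp only [Function.comp_apply, hc]
    rw [mul_smul, map_smul, smul_eq_mul, abs_mul, abs_of_nonneg (by positivity), mul_comm]
  have htot : HasSum c (φ (D.matFun f)) := (D.hasSum_matFun hρ hf (by omega)).map φ hφc
  have herr : φ (ChebMatrix.chebPartialSum f N A - D.matFun f) = -∑' i, c (i + (N + 1)) := by
    have h1 := htot.summable.sum_add_tsum_nat_add (N + 1)
    rw [htot.tsum_eq] at h1
    rw [map_sub, ← h1, ChebMatrix.chebPartialSum, map_sum]
    ring
  -- The scalar series is `φ` applied to the matrix series `G t`.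
  have hg : ∀ t ∈ Icc (-1 : ℝ) 1,
      |∑' n, c n * (derivative^[ℓ + 1] (ChebMatrix.chebT n)).eval t| ≤
        ν (∑' n, ChebMatrix.chebDerivTerm f A (ℓ + 1) t n) := by
    intro t ht
    refine le_of_eq_of_le ?_ (hle _)
    rw [((hsum t ht).hasSum.map φ hφc).tsum_eq.symm]
    congr 1
    refine tsum_congr fun n => ?_
    simp only [Function.comp_apply, hc, ChebMatrix.chebDerivTerm, map_smul, smul_eq_mul]
    ring
  rw [← hφ, herr]
  refine (neg_le_abs _).trans ((ChebMatrix.abs_tsum_tail_le hℓ hcs hN).trans ?_)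
  have hx : 0 < (N : ℝ) - ℓ := sub_pos.2 (Nat.cast_lt.2 hN)
  refine mul_le_mul_of_nonneg_right (mul_le_mul_of_nonneg_left ?_ (by positivity)) (by positivity)
  refine intervalIntegral.integral_mono_on (by norm_num) ?_ hint hg
  refine ContinuousOn.intervalIntegrable ?_
  rw [ChebMatrix.uIcc_neg_one_one]
  exact (ChebMatrix.continuousOn_chebSeries hcs).abs
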